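/- **Theorem 1.6.** Conventions: $\mathbb{R}^d$ carries the standard inner product, and $\|\cdot\|$ is the associated operator norm of $d\times d$ matrices. For a finite nonempty set $A\subseteq\mathbb{R}^d$ put $\delta_A=\frac{1}{\#A}\sum_{a\in A}\delta_a$. Let $R$ be a $d\times d$ integer matrix all of whose eigenvalues have modulus strictly greater than $1$, and let $B\subseteq\mathbb{Z}^d$ be finite. The pair $(R,B)$ is *admissible* if there is a finite set $L\subseteq\mathbb{Z}^d$ with $\#L=\#B$ such that the matrix $$\left[\tfrac{1}{\sqrt{\#B}}\,e^{-2\pi i\,(R^{-1}b)\cdot \ell}\right]_{b\in B,\ \ell\in L}$$ is unitary. Let $\mathcal{D}_d$ be the set of all pairs $(R,B)$ with $R=\mathrm{diag}(m_1,\dots,m_d)$, where $m_1,\dots,m_d\ge 2$ are integers, and $B$ a nonempty subset of $\{0,\dots,m_1-1\}\times\cdots\times\{0,\dots,m_d-1\}$. Let $\{(R_n,B_n)\}_{n=1}^\infty\subseteq\mathcal{D}_d$ be a sequence of admissible pairs with $$\sup_{n\ge 1}\|R_n\|<\infty .$$ Then the measures $$\mu_n=\delta_{R_1^{-1}B_1}*\delta_{(R_2R_1)^{-1}B_2}*\cdots*\delta_{(R_n\cdots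 R_2R_1)^{-1}B_n}$$ converge weakly to a Borel probability measure $\mu$ on $\mathbb{R}^d$ (the infinite convolution), and $\mu$ is a spectral measure with a spectrum in $\mathbb{Z}^d$: there is a countable set $\Lambda\subseteq\mathbb{Z}^d$ such that $\{e^{2\pi i\lambda\cdot x}:\lambda\in\Lambda\}$ is an orthonormal basis of $L^2(\mu)$. -/

import Mathlib

open MeasureTheory Filter Topology
open scoped BoundedContinuousFunction

noncomputable section

namespace InfConv

/-- `ℝ^d` with the Euclidean norm and the standard inner product. -/
abbrev Rd (d : ℕ) : Type := EuclideanSpace ℝ (Fin d)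

/-- The real matrix with the same entries as the integral matrix `R`. -/
def realMat {d : ℕ} (R : Matrix (Fin d) (Fin d) ℤ) : Matrix (Fin d) (Fin d) ℝ :=
  R.map (fun a : ℤ => (a : ℝ))

/-- The integral vector `k ∈ ℤ^d`, seen as a vector of `ℝ^d`. -/
def intVec {d : ℕ} (k : Fin d → ℤ) : Rd d :=
  WithLp.toLp 2 (fun i => (k i : ℝ))

/-- The lattice `ℤ^d` in `ℝ^d`. -/
def intLattice (d : ℕ) : Set (Rd d) := Set.range (intVec (d := d))

/-- The vector `R⁻¹ b ∈ ℝ^d`, for an integral matrix `R` and an integral vector `b`. -/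
def invApply {d : ℕ} (R : Matrix (Fin d) (Fin d) ℤ) (b : Fin d → ℤ) : Rd d :=
  WithLp.toLp 2 (Matrix.mulVec (realMat R)⁻¹ (fun i => (b i : ℝ)))

/-- The operator norm of the integral matrix `R` for the Euclidean norm of `ℝ^d`. -/
def opNorm {d : ℕ} (R : Matrix (Fin d) (Fin d) ℤ) : ℝ :=
  ‖Matrix.toEuclideanCLM (n := Fin d) (𝕜 := ℝ) (realMat R)‖

/-- `R` is expanding: all its (complex) eigenvalues have modulus `> 1`. -/
def IsExpanding {d : ℕ} (R : Matrix (Fin d) (Fin d) ℤ) : Prop :=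
  ∀ z ∈ spectrum ℂ (R.map (fun a : ℤ => (a : ℂ))), 1 < ‖z‖

/-- The matrix `[ (#B)^{-1/2} exp(-2πi (R⁻¹ b) · ℓ) ]`, `b ∈ B`, `ℓ ∈ L`. -/
def hadamardMatrix {d : ℕ} (R : Matrix (Fin d) (Fin d) ℤ) (B L : Finset (Fin d → ℤ)) :
    Matrix B L ℂ :=
  Matrix.of fun b l =>
    ((1 / Real.sqrt (B.card : ℝ) : ℝ) : ℂ) *
      Complex.exp (-(2 * (Real.pi : ℂ) * Complex.I *
        ((inner ℝ (invApply R b.1) (intVec l.1) : ℝ) : ℂ)))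

/-- `(R, B)` is an admissible pair in `ℝ^d`. -/
def IsAdmissiblePair {d : ℕ} (R : Matrix (Fin d) (Fin d) ℤ) (B : Finset (Fin d → ℤ)) : Prop :=
  IsExpanding R ∧
    ∃ L : Finset (Fin d → ℤ), L.card = B.card ∧
      hadamardMatrix R B L * (hadamardMatrix R B L).conjTranspose = 1 ∧
      (hadamardMatrix R B L).conjTranspose * hadamardMatrix R B L = 1

/-- The class `𝒟_d`: `R = diag(m_1, …, m_d)` with integers `m_i ≥ 2`, and `B` is a nonempty subset
of `∏ {0, …, m_i - 1}`. -/
def MemD {d : ℕ} (R : Matrix (Fin d) (Fin d) ℤ) (B : Finset (Fin d → ℤ)) : Prop :=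
  ∃ m : Fin d → ℤ, (∀ i, 2 ≤ m i) ∧ R = Matrix.diagonal m ∧
    B.Nonempty ∧ ∀ b ∈ B, ∀ i, 0 ≤ b i ∧ b i ≤ m i - 1

/-- The uniform discrete measure `δ_A = (#A)⁻¹ ∑_{a ∈ A} δ_a` on a finite set `A ⊆ ℝ^d`. -/
def unifMeasure {d : ℕ} (A : Finset (Rd d)) : Measure (Rd d) :=
  (A.card : ENNReal)⁻¹ • ∑ a ∈ A, Measure.dirac a

open Classical in
/-- The finite set `R⁻¹ B ⊆ ℝ^d`. -/
def invImage {d : ℕ} (R : Matrix (Fin d) (Fin d) ℤ) (B : Finset (Fin d → ℤ)) : Finset (Rd d) :=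
  B.image (invApply R)

/-- The product `R_{n-1} ⋯ R_1 R_0` of the first `n` terms of a sequence indexed from `0`. -/
def prodMat {d : ℕ} (R : ℕ → Matrix (Fin d) (Fin d) ℤ) : ℕ → Matrix (Fin d) (Fin d) ℤ
  | 0 => 1
  | n + 1 => R n * prodMat R n

/-- The `n`-fold convolution
`μ_n = δ_{R_0⁻¹ B_0} * δ_{(R_1 R_0)⁻¹ B_1} * ⋯ * δ_{(R_{n-1} ⋯ R_0)⁻¹ B_{n-1}}`
(the empty convolution `μ_0` is the Dirac measure at the origin). -/
def partialConv {d : ℕ} (R : ℕ → Matrix (Fin d) (Fin d) ℤ) (B : ℕ → Finset (Fin d → ℤ)) :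
    ℕ → Measure (Rd d)
  | 0 => Measure.dirac 0
  | n + 1 => (partialConv R B n).conv (unifMeasure (invImage (prodMat R (n + 1)) (B n)))

/-- `μ` is the infinite convolution of the sequence `(R_n, B_n)`: the measures `μ_n` converge
weakly to the Borel probability measure `μ`. -/
def IsInfiniteConvolution {d : ℕ} (R : ℕ → Matrix (Fin d) (Fin d) ℤ)
    (B : ℕ → Finset (Fin d → ℤ)) (μ : Measure (Rd d)) : Prop :=
  IsProbabilityMeasure μ ∧
    ∀ f : Rd d →ᵇ ℝ, Tendsto (fun n => ∫ x, f x ∂(partialConv R B n)) atTop (𝓝 (∫ x, f x ∂μ))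

/-- `Λ` is a spectrum of `μ`: `Λ` is countable and the exponentials `x ↦ exp(2πi λ · x)`, `λ ∈ Λ`,
form an orthonormal (Hilbert) basis of `L²(μ)`. -/
def IsSpectrum {d : ℕ} (μ : Measure (Rd d)) (Λ : Set (Rd d)) : Prop :=
  Λ.Countable ∧ ∃ e : HilbertBasis Λ ℂ (Lp ℂ 2 μ), ∀ l : Λ,
    (e l : Rd d → ℂ) =ᵐ[μ] fun x =>
      Complex.exp (2 * (Real.pi : ℂ) * Complex.I * ((inner ℝ l.1 x : ℝ) : ℂ))

end InfConv

end

/-!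
The infinite convolution `μ` is the law of the random series `∑ (R_k ⋯ R_1)⁻¹ b_k` with independent
uniform digits `b_k ∈ B_k`; it lives in the unit cube. Of two opposite faces of the cube one is
`μ`-null: a point lies on the face `x_i = 0` only if the `i`-th coordinate of every digit is
minimal, on the face `x_i = 1` only if it is always maximal, and the product of the two
probabilities is at most `4⁻ⁿ` for every `n`. Hence the projection to the torus is injective
`μ`-almost everywhere, the integral exponentials are total in `L²(μ)`, and for no `ξ` can the
Fourier transform `μ̂` vanish on all of `ξ + ℤ^d`.

Since the `R_n` are bounded, the sequences of digit systems and the points `ξ` modulo `ℤ^d` range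
over a compact space on which `μ̂(ξ)` is continuous, so this nonvanishing is uniform over `μ` and
the infinite convolutions of all its tails. A spectrum of `μ_n` is built digit by digit from the
admissible pairs, and its points may be translated by `R_n ⋯ R_1 ℤ^d`. Placing the new
points where the transform of the tail is bounded below gives an increasing sequence of spectra
along which `|μ̂_n|` is dominated by a multiple of `|μ̂|`. Dominated convergence then carries the
identity `∑ |μ̂_n(ξ + λ)|² = 1` over to `μ`, which together with totality makes the union of the
spectra a spectrum of `μ`.
-/

noncomputable section

namespace InfConv

variable {d : ℕ}

section Character

variable {E : Type*} [NormedAddCommGroup E] [InnerProductSpace ℝ E]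

/-- The character `x ↦ exp(2πi ξ · x)` of a real inner product space. -/
def wave (ξ x : E) : ℂ := Real.fourierChar (inner ℝ ξ x)

lemma wave_eq_exp (ξ x : E) :
    wave ξ x = Complex.exp (2 * (Real.pi : ℂ) * Complex.I * ((inner ℝ ξ x : ℝ) : ℂ)) := by
  rw [wave, Real.fourierChar_apply]
  push_cast
  ring_nf

@[simp] lemma norm_wave (ξ x : E) : ‖wave ξ x‖ = 1 := Circle.norm_coe _

lemma wave_comm (ξ x : E) : wave ξ x = wave x ξ := by rw [wave, wave, real_inner_comm]

lemma wave_add_left (ξ η x : E) : wave (ξ + η) x = wave ξ x * wave η x := by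
  rw [wave, inner_add_left, AddChar.map_add_eq_mul, Circle.coe_mul, wave, wave]

lemma wave_neg_left (ξ x : E) : wave (-ξ) x = (starRingEnd ℂ) (wave ξ x) := by
  rw [wave, inner_neg_left, AddChar.map_neg_eq_inv, Circle.coe_inv_eq_conj, wave]

@[simp] lemma wave_zero_right (ξ : E) : wave ξ 0 = 1 := by simp [wave]

@[fun_prop]
lemma continuous_wave (ξ : E) : Continuous (wave ξ) := by
  unfold wave
  fun_prop

lemma norm_wave_sub_le (ξ x y : E) : ‖wave ξ x - wave ξ y‖ ≤ 2 * Real.pi * ‖ξ‖ * ‖x - y‖ := by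
  have hfactor : wave ξ x - wave ξ y = wave ξ y * (wave ξ (x - y) - 1) := by
    rw [wave_comm ξ (x - y), mul_sub, mul_one, wave_comm ξ y, ← wave_add_left, add_sub_cancel,
      wave_comm x]
  rw [hfactor, norm_mul, norm_wave, one_mul, wave, Real.fourierChar_apply, mul_comm _ Complex.I]
  calc _ ≤ ‖2 * Real.pi * inner ℝ ξ (x - y)‖ := Real.norm_exp_I_mul_ofReal_sub_one_le
    _ = 2 * Real.pi * |inner ℝ ξ (x - y)| := by
      rw [Real.norm_eq_abs, abs_mul, abs_of_pos Real.two_pi_pos]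
    _ ≤ 2 * Real.pi * (‖ξ‖ * ‖x - y‖) := by gcongr; exact abs_real_inner_le_norm _ _
    _ = 2 * Real.pi * ‖ξ‖ * ‖x - y‖ := by ring

end Character

section FourierTransform

variable {E : Type*} [NormedAddCommGroup E] [InnerProductSpace ℝ E] [MeasurableSpace E]

/-- The Fourier transform of a measure, with the sign convention of the exponentials whose
orthogonality is studied: `ft μ ξ` is `μ̂(-ξ)` in the usual notation. -/
def ft (μ : Measure E) (ξ : E) : ℂ := ∫ x, wave ξ x ∂μ

lemma ft_eq_charFun (μ : Measure E) (ξ : E) : ft μ ξ = charFun μ ((2 * Real.pi) • ξ) := by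
  simp_rw [ft, charFun_apply, wave, Real.fourierChar_apply, inner_smul_right, real_inner_comm]

@[simp] lemma ft_zero (μ : Measure E) [IsProbabilityMeasure μ] : ft μ 0 = 1 := by
  simp [ft_eq_charFun]

lemma ft_neg (μ : Measure E) (ξ : E) : ft μ (-ξ) = (starRingEnd ℂ) (ft μ ξ) := by
  rw [ft_eq_charFun, smul_neg, charFun_neg, ft_eq_charFun]

lemma norm_ft_sub_comm (μ : Measure E) (ξ η : E) : ‖ft μ (ξ - η)‖ = ‖ft μ (η - ξ)‖ := by
  rw [← neg_sub η ξ, ft_neg, RCLike.norm_conj]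

variable [BorelSpace E]

lemma integrable_wave (μ : Measure E) [IsFiniteMeasure μ] (ξ : E) : Integrable (wave ξ) μ :=
  .of_bound (continuous_wave ξ).aestronglyMeasurable 1 (by simp)

lemma ft_conv [SecondCountableTopology E] (μ ν : Measure E) [IsFiniteMeasure μ] [IsFiniteMeasure ν]
    (ξ : E) : ft (μ.conv ν) ξ = ft μ ξ * ft ν ξ := by
  simp_rw [ft_eq_charFun, charFun_conv]

variable {Ω : Type*} [MeasurableSpace Ω] (P : Measure Ω) {X Y : Ω → E}

lemma integrable_wave_comp [IsFiniteMeasure P] (hX : AEMeasurable X P) (ξ : E) :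
    Integrable (fun a => wave ξ (X a)) P :=
  (integrable_wave _ ξ).comp_aemeasurable hX

variable {c : ℝ}

lemma norm_ft_map_sub_ft_map_le [IsProbabilityMeasure P] (hX : AEMeasurable X P)
    (hY : AEMeasurable Y P) (h : ∀ᵐ a ∂P, ‖X a - Y a‖ ≤ c) (ξ : E) :
    ‖ft (P.map X) ξ - ft (P.map Y) ξ‖ ≤ 2 * Real.pi * ‖ξ‖ * c := by
  have hsub : ft (P.map X) ξ - ft (P.map Y) ξ = ∫ a, (wave ξ (X a) - wave ξ (Y a)) ∂P := by
    rw [integral_sub (integrable_wave_comp P hX ξ) (integrable_wave_comp P hY ξ), ft, ft,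
      integral_map hX (continuous_wave ξ).aestronglyMeasurable,
      integral_map hY (continuous_wave ξ).aestronglyMeasurable]
  rw [hsub]
  refine (norm_integral_le_of_norm_le_const (C := 2 * Real.pi * ‖ξ‖ * c) ?_).trans (by simp)
  filter_upwards [h] with a ha
  exact (norm_wave_sub_le ξ _ _).trans (by gcongr)

lemma norm_ft_sub_le {μ : Measure E} [IsProbabilityMeasure μ] (h : ∀ᵐ x ∂μ, ‖x‖ ≤ c) (ξ η : E) :
    ‖ft μ ξ - ft μ η‖ ≤ 2 * Real.pi * c * ‖ξ - η‖ := by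
  rw [ft, ft, ← integral_sub (integrable_wave μ ξ) (integrable_wave μ η)]
  refine (norm_integral_le_of_norm_le_const (C := 2 * Real.pi * c * ‖ξ - η‖) ?_).trans (by simp)
  filter_upwards [h] with x hx
  rw [wave_comm ξ, wave_comm η]
  exact (norm_wave_sub_le x ξ η).trans (by gcongr)

end FourierTransform

section SquareIntegrable

variable {E : Type*} [NormedAddCommGroup E] [InnerProductSpace ℝ E] [MeasurableSpace E]
  [BorelSpace E] (μ : Measure E) [IsFiniteMeasure μ]

lemma memLp_wave (ξ : E) : MemLp (wave ξ) 2 μ :=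
  .of_bound (continuous_wave ξ).aestronglyMeasurable 1 (by simp)

/-- The character `wave ξ` as an element of `L²(μ)`. -/
def waveLp (ξ : E) : Lp ℂ 2 μ := (memLp_wave μ ξ).toLp

lemma coeFn_waveLp (ξ : E) : waveLp μ ξ =ᵐ[μ] wave ξ := MemLp.coeFn_toLp _

lemma inner_waveLp_left (ξ : E) (f : Lp ℂ 2 μ) :
    inner ℂ (waveLp μ ξ) f = ∫ x, wave (-ξ) x * f x ∂μ := by
  rw [L2.inner_def]
  refine integral_congr_ae ?_
  filter_upwards [coeFn_waveLp μ ξ] with x hx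
  rw [hx, RCLike.inner_apply, wave_neg_left, mul_comm]

lemma inner_waveLp (ξ η : E) : inner ℂ (waveLp μ ξ) (waveLp μ η) = ft μ (η - ξ) := by
  rw [inner_waveLp_left, ft]
  refine integral_congr_ae ?_
  filter_upwards [coeFn_waveLp μ η] with x hx
  rw [hx, sub_eq_neg_add, wave_add_left]

lemma norm_waveLp [IsProbabilityMeasure μ] (ξ : E) : ‖waveLp μ ξ‖ = 1 := by
  rw [@norm_eq_sqrt_re_inner ℂ, inner_waveLp]
  simp

end SquareIntegrable

section IntegerVectors

@[simp] lemma intVec_apply (k : Fin d → ℤ) (i : Fin d) : intVec k i = k i := rfl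

@[simp] lemma intVec_zero : intVec (0 : Fin d → ℤ) = 0 := by
  ext i
  simp

lemma intVec_add (k l : Fin d → ℤ) : intVec (k + l) = intVec k + intVec l := by
  ext i
  simp

lemma intVec_sub (k l : Fin d → ℤ) : intVec (k - l) = intVec k - intVec l := by
  ext i
  simp

lemma intVec_injective : Function.Injective (intVec (d := d)) := fun k l h => by
  funext i
  simpa using congrArg (fun x : Rd d => x i) h

lemma wave_intVec_intVec (k l : Fin d → ℤ) : wave (intVec k) (intVec l) = 1 := by
  rw [wave_eq_exp, Complex.exp_eq_one_iff]
  refine ⟨∑ i, k i * l i, ?_⟩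
  simp only [PiLp.inner_apply, intVec_apply, Real.inner_apply]
  push_cast
  ring

/-- Coordinatewise division by the integral vector `p`, that is, the map `diag(p)⁻¹`. -/
def scale (p : Fin d → ℤ) : Rd d →ₗ[ℝ] Rd d where
  toFun x := WithLp.toLp 2 fun i => x i / p i
  map_add' x y := by ext i; simp [add_div]
  map_smul' c x := by ext i; simp [mul_div_assoc]

@[simp] lemma scale_apply (p : Fin d → ℤ) (x : Rd d) (i : Fin d) : scale p x i = x i / p i := rfl

lemma scale_scale (p q : Fin d → ℤ) (x : Rd d) : scale p (scale q x) = scale (q * p) x := by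
  ext i
  simp [div_div]

lemma scale_mul_intVec {p : Fin d → ℤ} (hp : ∀ i, p i ≠ 0) (k : Fin d → ℤ) :
    scale p (intVec (p * k)) = intVec k := by
  ext i
  have hpi : (p i : ℝ) ≠ 0 := by exact_mod_cast hp i
  simp [hpi]

lemma scale_intVec_injective {p : Fin d → ℤ} (hp : ∀ i, p i ≠ 0) :
    Function.Injective fun b => scale p (intVec b) := fun b c h => by
  funext i
  have hpi : (p i : ℝ) ≠ 0 := by exact_mod_cast hp i
  simpa [div_left_inj' hpi] using congrArg (fun x : Rd d => x i) h

lemma wave_scale (p : Fin d → ℤ) (x y : Rd d) : wave x (scale p y) = wave (scale p x) y := by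
  rw [wave, wave]
  congr 2
  simp only [PiLp.inner_apply, scale_apply, Real.inner_apply]
  exact Finset.sum_congr rfl fun i _ => by ring

lemma norm_le_sqrt_mul {x : Rd d} {c : ℝ} (h : ∀ i, |x i| ≤ c) : ‖x‖ ≤ √d * |c| := by
  rw [EuclideanSpace.norm_eq, ← Real.sqrt_sq_eq_abs, ← Real.sqrt_mul (Nat.cast_nonneg d)]
  refine Real.sqrt_le_sqrt ?_
  calc ∑ i, ‖x i‖ ^ 2 ≤ ∑ _i : Fin d, c ^ 2 := by
        gcongr with i
        exact h i
    _ = d * c ^ 2 := by simp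

end IntegerVectors

section Totality

/-- The integral characters are total in `L²(μ)`: a square integrable function orthogonal to all of
them vanishes almost everywhere. -/
def IntegralWavesTotal (μ : Measure (Rd d)) : Prop :=
  ∀ f : Rd d → ℂ, MemLp f 2 μ → (∀ k, ∫ x, wave (intVec k) x * f x ∂μ = 0) → f =ᵐ[μ] 0

lemma IntegralWavesTotal.exists_ft_add_intVec_ne_zero {μ : Measure (Rd d)} [IsFiniteMeasure μ]
    [NeZero μ] (h : IntegralWavesTotal μ) (ξ : Rd d) : ∃ k, ft μ (ξ + intVec k) ≠ 0 := by
  by_contra! hzero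
  have hwave : wave ξ =ᵐ[μ] 0 := h _ (memLp_wave μ ξ) fun k => by
    simp_rw [← wave_add_left, add_comm (intVec k)]
    exact hzero k
  obtain ⟨x, hx⟩ := hwave.exists
  simpa [hx] using norm_wave ξ x

/-- The projection of `ℝ^d` onto the torus `(ℝ / ℤ)^d`. -/
def toTorus (x : Rd d) : UnitAddTorus (Fin d) := fun i => (x i : UnitAddCircle)

lemma measurable_toTorus : Measurable (toTorus (d := d)) :=
  measurable_pi_lambda _ fun i => AddCircle.measurable_mk'.comp (by fun_prop)

lemma wave_intVec_eq_mFourier (k : Fin d → ℤ) (x : Rd d) :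
    wave (intVec k) x = UnitAddTorus.mFourier k (toTorus x) := by
  simp only [UnitAddTorus.mFourier, toTorus, ContinuousMap.coe_mk, fourier_coe_apply,
    ← Complex.exp_sum, wave_eq_exp, PiLp.inner_apply, intVec_apply, Real.inner_apply]
  push_cast
  rw [Finset.mul_sum]
  congr! 2 with i
  ring

lemma exists_measurable_circle_lift {α : Type*} [MeasurableSpace α] {μ : Measure α} {X : α → ℝ}
    (hX : ∀ᵐ a ∂μ, X a ∈ Set.Icc 0 1) (hface : μ {a | X a = 0} = 0 ∨ μ {a | X a = 1} = 0) :
    ∃ e : UnitAddCircle → ℝ, Measurable e ∧ ∀ᵐ a ∂μ, e (X a) = X a := by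
  rcases hface with h | h
  · refine ⟨fun t => AddCircle.measurableEquivIoc (1 : ℝ) 0 t,
      measurable_subtype_coe.comp (MeasurableEquiv.measurable _), ?_⟩
    have hne : ∀ᵐ a ∂μ, X a ≠ 0 := by simpa [ae_iff] using h
    filter_upwards [hX, hne] with a ha ha0
    exact AddCircle.equivIoc_coe_of_mem (p := (1 : ℝ)) (a := 0)
      ⟨ha.1.lt_of_ne' ha0, by simpa using ha.2⟩
  · refine ⟨fun t => AddCircle.measurableEquivIco (1 : ℝ) 0 t,
      measurable_subtype_coe.comp (MeasurableEquiv.measurable _), ?_⟩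
    have hne : ∀ᵐ a ∂μ, X a ≠ 1 := by simpa [ae_iff] using h
    filter_upwards [hX, hne] with a ha ha1
    exact AddCircle.equivIco_coe_of_mem (p := (1 : ℝ)) (a := 0)
      ⟨ha.1, by simpa using ha.2.lt_of_ne ha1⟩

lemma exists_measurable_section_toTorus {μ : Measure (Rd d)}
    (hcube : ∀ᵐ x ∂μ, ∀ i, x i ∈ Set.Icc (0 : ℝ) 1)
    (hface : ∀ i, μ {x | x i = 0} = 0 ∨ μ {x | x i = 1} = 0) :
    ∃ s : UnitAddTorus (Fin d) → Rd d, Measurable s ∧ ∀ᵐ x ∂μ, s (toTorus x) = x := by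
  choose e hmeas he using fun i => exists_measurable_circle_lift (X := fun x : Rd d => x i)
    (hcube.mono fun x hx => hx i) (hface i)
  refine ⟨fun t => WithLp.toLp 2 fun i => e i (t i), ?_, ?_⟩
  · exact (PiLp.continuous_toLp 2 _).measurable.comp
      (measurable_pi_lambda _ fun i => (hmeas i).comp (measurable_pi_apply i))
  · filter_upwards [ae_all_iff.2 he] with x hx
    ext i
    exact hx i

section Torus

variable {ι : Type*} [Fintype ι] (m : Measure (UnitAddTorus ι)) [IsFiniteMeasure m]

lemma span_toLp_mFourier_closure_eq_top {p : ENNReal} [Fact (1 ≤ p)] (hp : p ≠ ⊤) :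
    (Submodule.span ℂ (Set.range fun k : ι → ℤ =>
      ContinuousMap.toLp p m ℂ (UnitAddTorus.mFourier k))).topologicalClosure = ⊤ := by
  simpa only [Submodule.map_span, ContinuousLinearMap.coe_coe, ← Set.range_comp,
    Function.comp_def] using
    (ContinuousMap.toLp_denseRange ℂ m ℂ hp).topologicalClosure_map_submodule
      UnitAddTorus.span_mFourier_closure_eq_top

lemma ae_eq_zero_of_integral_mFourier {g : UnitAddTorus ι → ℂ} (hg : MemLp g 2 m)
    (h : ∀ k, ∫ t, UnitAddTorus.mFourier k t * g t ∂m = 0) : g =ᵐ[m] 0 := by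
  have horth (k : ι → ℤ) :
      inner ℂ (ContinuousMap.toLp 2 m ℂ (UnitAddTorus.mFourier k)) (hg.toLp g) = 0 := by
    rw [L2.inner_def, ← h (-k)]
    refine integral_congr_ae ?_
    filter_upwards [ContinuousMap.coeFn_toLp (p := 2) (𝕜 := ℂ) m (UnitAddTorus.mFourier k),
      hg.coeFn_toLp] with t ht hgt
    rw [ht, hgt, RCLike.inner_apply, UnitAddTorus.mFourier_neg, mul_comm]
  have hzero : hg.toLp g = 0 := by
    have hdense := Submodule.dense_iff_topologicalClosure_eq_top.2
      (span_toLp_mFourier_closure_eq_top (p := 2) m ENNReal.ofNat_ne_top)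
    refine hdense.eq_zero_of_mem_orthogonal ((Submodule.mem_orthogonal _ _).2 fun u hu => ?_)
    induction hu using Submodule.span_induction with
    | mem x hx => obtain ⟨k, rfl⟩ := hx; exact horth k
    | zero => simp
    | add x y _ _ hx hy => rw [inner_add_left, hx, hy, add_zero]
    | smul c x _ hx => rw [inner_smul_left, hx, mul_zero]
  exact (MemLp.toLp_eq_toLp_iff hg .zero).1 hzero

end Torus

theorem integralWavesTotal_of_unitCube {μ : Measure (Rd d)} [IsFiniteMeasure μ]
    (hcube : ∀ᵐ x ∂μ, ∀ i, x i ∈ Set.Icc (0 : ℝ) 1)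
    (hface : ∀ i, μ {x | x i = 0} = 0 ∨ μ {x | x i = 1} = 0) : IntegralWavesTotal μ := by
  intro f hf h
  obtain ⟨s, hs, hsec⟩ := exists_measurable_section_toTorus hcube hface
  have hcomp : (f ∘ s) ∘ toTorus =ᵐ[μ] f := by
    filter_upwards [hsec] with x hx
    simp [hx]
  have hmap : (μ.map toTorus).map s = μ := by
    have hid : s ∘ toTorus =ᵐ[μ] id := hsec
    rw [Measure.map_map hs measurable_toTorus, Measure.map_congr hid, Measure.map_id]
  have hg : MemLp (f ∘ s) 2 (μ.map toTorus) :=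
    (memLp_map_measure_iff (hmap.symm ▸ hf.1) hs.aemeasurable).1 (hmap.symm ▸ hf)
  have hzero := ae_eq_zero_of_integral_mFourier _ hg fun k => by
    rw [integral_map (f := fun t => UnitAddTorus.mFourier k t * (f ∘ s) t)
      measurable_toTorus.aemeasurable
      ((map_continuous _).aestronglyMeasurable.mul hg.1), ← h k]
    refine integral_congr_ae ?_
    filter_upwards [hcomp] with x hx
    rw [wave_intVec_eq_mFourier, ← hx, Function.comp_apply, Function.comp_apply,
      Function.comp_apply]
  exact hcomp.symm.trans (ae_of_ae_map measurable_toTorus.aemeasurable hzero)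

end Totality

section Parseval

lemma mem_topologicalClosure_span_of_tsum_inner_sq {𝕜 E ι : Type*} [RCLike 𝕜]
    [NormedAddCommGroup E] [InnerProductSpace 𝕜 E] [CompleteSpace E] {v : ι → E}
    (hv : Orthonormal 𝕜 v) {x : E} (h : ∑' i, ‖inner 𝕜 (v i) x‖ ^ 2 = ‖x‖ ^ 2) :
    x ∈ (Submodule.span 𝕜 (Set.range v)).topologicalClosure := by
  set U := (Submodule.span 𝕜 (Set.range v)).topologicalClosure
  have hvU (i : ι) : v i ∈ U := Submodule.le_topologicalClosure _ (Submodule.subset_span ⟨i, rfl⟩)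
  have hinner (i : ι) : inner 𝕜 (v i) (U.starProjection x) = inner 𝕜 (v i) x := by
    rw [← Submodule.inner_starProjection_left_eq_right,
      Submodule.starProjection_eq_self_iff.2 (hvU i)]
  have hbessel := hv.tsum_inner_products_le (U.starProjection x)
  simp_rw [hinner, h] at hbessel
  exact (Submodule.mem_iff_norm_starProjection U x).2 <|
    (U.norm_starProjection_apply_le x).antisymm (le_of_sq_le_sq hbessel (norm_nonneg _))

variable {μ ν ρ : Measure (Rd d)}

/-- The set `Λ ⊆ ℤ^d` of frequencies satisfies Parseval's identity for every character in `L²(μ)`.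
By Jorgensen and Pedersen this is how spectra are recognized from the Fourier transform. -/
def IsParsevalSet (μ : Measure (Rd d)) (Λ : Set (Fin d → ℤ)) : Prop :=
  ∀ ξ, HasSum (fun l : Λ => ‖ft μ (ξ + intVec l)‖ ^ 2) 1

lemma isParsevalSet_coe {Λ : Finset (Fin d → ℤ)} :
    IsParsevalSet μ Λ ↔ ∀ ξ, ∑ l ∈ Λ, ‖ft μ (ξ + intVec l)‖ ^ 2 = 1 :=
  forall_congr' fun ξ =>
    have hsum := Λ.hasSum fun l => ‖ft μ (ξ + intVec l)‖ ^ 2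
    ⟨hsum.unique, fun h => h ▸ hsum⟩

lemma IsParsevalSet.ft_sub_eq_zero [IsProbabilityMeasure μ] {Λ : Set (Fin d → ℤ)}
    (h : IsParsevalSet μ Λ) {k l : Fin d → ℤ} (hk : k ∈ Λ) (hl : l ∈ Λ) (hkl : k ≠ l) :
    ft μ (intVec k - intVec l) = 0 := by
  classical
  have hne : (⟨k, hk⟩ : Λ) ≠ ⟨l, hl⟩ := by simpa using hkl
  have hpair := sum_le_hasSum {⟨k, hk⟩, ⟨l, hl⟩} (fun _ _ => by positivity) (h (-intVec l))
  rw [Finset.sum_pair hne, neg_add_cancel, ft_zero, norm_one, one_pow, add_le_iff_nonpos_left,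
    neg_add_eq_sub] at hpair
  simpa using hpair.antisymm (by positivity)

theorem IsParsevalSet.isSpectrum [IsProbabilityMeasure μ] {Λ : Set (Fin d → ℤ)}
    (h : IsParsevalSet μ Λ) (htotal : IntegralWavesTotal μ) : IsSpectrum μ (intVec '' Λ) := by
  have horth : Orthonormal ℂ fun l : intVec '' Λ => waveLp μ l := by
    refine ⟨fun l => norm_waveLp μ _, ?_⟩
    rintro ⟨_, k, hk, rfl⟩ ⟨_, l, hl, rfl⟩ hne
    exact (inner_waveLp μ _ _).trans <| h.ft_sub_eq_zero hl hk fun hlk => hne (by simp [hlk])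
  have hparseval (ξ : Rd d) : HasSum (fun l : intVec '' Λ => ‖ft μ (ξ + l)‖ ^ 2) 1 :=
    (Equiv.Set.image _ Λ intVec_injective).hasSum_iff.1 (h ξ)
  have hspan : (Submodule.span ℂ (Set.range fun l : intVec '' Λ => waveLp μ l))ᗮ = ⊥ := by
    rw [← Submodule.orthogonal_closure, eq_bot_iff]
    intro f hf
    have hzero := htotal f (Lp.memLp f) fun k => by
      rw [← neg_neg (intVec k), ← inner_waveLp_left]
      refine hf _ (mem_topologicalClosure_span_of_tsum_inner_sq horth ?_)
      simp_rw [norm_waveLp, inner_waveLp, norm_ft_sub_comm μ (-intVec k), sub_neg_eq_add,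
        add_comm _ (intVec k), (hparseval _).tsum_eq, one_pow]
    exact (Submodule.mem_bot ℂ).2 (Lp.eq_zero_iff_ae_eq_zero.2 hzero)
  refine ⟨(Set.to_countable Λ).image _, .mkOfOrthogonalEqBot horth hspan, fun l => ?_⟩
  rw [HilbertBasis.coe_mkOfOrthogonalEqBot]
  simp_rw [← wave_eq_exp]
  exact coeFn_waveLp μ (l : Rd d)

lemma IsParsevalSet.image_add_right {Λ : Set (Fin d → ℤ)} (h : IsParsevalSet μ Λ)
    (k : Fin d → ℤ) : IsParsevalSet μ ((· + k) '' Λ) := fun ξ => by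
  rw [← (Equiv.Set.image _ Λ (add_left_injective k)).hasSum_iff]
  simpa [Function.comp_def, intVec_add, add_assoc, add_comm (intVec k)] using h (ξ + intVec k)

lemma exists_zero_mem_isParsevalSet (h : ∃ L : Finset (Fin d → ℤ), IsParsevalSet μ L) :
    ∃ L : Finset (Fin d → ℤ), 0 ∈ L ∧ IsParsevalSet μ L := by
  obtain ⟨L, hL⟩ := h
  obtain ⟨k, hk⟩ : L.Nonempty := by
    rw [Finset.nonempty_iff_ne_empty]
    rintro rfl
    simpa using isParsevalSet_coe.1 hL 0
  refine ⟨L.image (· + -k), Finset.mem_image.2 ⟨k, hk, by simp⟩, ?_⟩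
  rw [Finset.coe_image]
  exact hL.image_add_right (-k)

lemma hasSum_indicator_iUnion_of_tendsto {ι : Type*} {S : ℕ → Finset ι} (hS : Monotone S)
    {g : ℕ → ι → ℝ} {G : ι → ℝ} {a C : ℝ} (hC : 0 ≤ C) (hg : ∀ j i, 0 ≤ g j i)
    (hsum : ∀ j, ∑ i ∈ S j, g j i = a)
    (hlim : ∀ i, Tendsto (fun j => g j i) atTop (𝓝 (G i)))
    (hdom : ∀ᶠ j in atTop, ∀ i ∈ S j, g j i ≤ C * G i) :
    HasSum (Set.indicator (⋃ j, (S j : Set ι)) G) a := by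
  set U : Set ι := ⋃ j, (S j : Set ι)
  set f : ℕ → ι → ℝ := fun j => Set.indicator (S j) (g j)
  have hf_nonneg (j : ℕ) (i : ι) : 0 ≤ f j i := Set.indicator_nonneg (fun i _ => hg j i) i
  have hf_sum (j : ℕ) : HasSum (f j) a := by
    rw [← hsum j, ← hasSum_subtype_iff_indicator]
    exact (S j).hasSum _
  have hf_lim (i : ι) : Tendsto (fun j => f j i) atTop (𝓝 (U.indicator G i)) := by
    by_cases hi : i ∈ U
    · obtain ⟨J, hJ⟩ := Set.mem_iUnion.1 hi
      rw [Set.indicator_of_mem hi]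
      refine (hlim i).congr' ?_
      filter_upwards [eventually_ge_atTop J] with j hj
      exact (Set.indicator_of_mem (hS hj hJ) _).symm
    · have hzero (j : ℕ) : f j i = 0 :=
        Set.indicator_of_notMem (fun hij => hi (Set.mem_iUnion.2 ⟨j, hij⟩)) _
      simp [hzero, Set.indicator_of_notMem hi]
  have hG (i : ι) : 0 ≤ U.indicator G i := ge_of_tendsto' (hf_lim i) fun j => hf_nonneg j i
  have hsummable : Summable (U.indicator G) :=
    summable_of_sum_le hG fun T => le_of_tendsto' (tendsto_finsetSum T fun i _ => hf_lim i) fun j =>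
      sum_le_hasSum T (fun i _ => hf_nonneg j i) (hf_sum j)
  have hf_dom : ∀ᶠ j in atTop, ∀ i, ‖f j i‖ ≤ C * U.indicator G i := by
    filter_upwards [hdom] with j hj i
    rw [Real.norm_of_nonneg (hf_nonneg j i)]
    refine Set.indicator_le' (g := fun i => C * U.indicator G i) (fun i hi => ?_) (fun i _ => ?_) i
    · rw [Set.indicator_of_mem (Set.mem_iUnion.2 ⟨j, hi⟩)]
      exact hj i hi
    · exact mul_nonneg hC (hG i)
  have htsum := tendsto_tsum_of_dominated_convergence (hsummable.mul_left C) hf_lim hf_dom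
  simp_rw [(hf_sum _).tsum_eq] at htsum
  rw [tendsto_nhds_unique tendsto_const_nhds htsum]
  exact hsummable.hasSum

theorem isParsevalSet_iUnion_of_tendsto {ν : ℕ → Measure (Rd d)} {Λ : ℕ → Finset (Fin d → ℤ)}
    (hΛ : Monotone Λ) (hν : ∀ j, IsParsevalSet (ν j) (Λ j))
    (hlim : ∀ ξ, Tendsto (fun j => ft (ν j) ξ) atTop (𝓝 (ft μ ξ))) {C : ℝ}
    (hdom : ∀ ξ, ∀ᶠ j in atTop, ∀ l ∈ Λ j,
      ‖ft (ν j) (ξ + intVec l)‖ ≤ C * ‖ft μ (ξ + intVec l)‖) :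
    IsParsevalSet μ (⋃ j, (Λ j : Set (Fin d → ℤ))) := fun ξ => by
  refine hasSum_subtype_iff_indicator.2 <| hasSum_indicator_iUnion_of_tendsto hΛ
    (sq_nonneg C) (fun _ _ => by positivity) (fun j => isParsevalSet_coe.1 (hν j) ξ)
    (fun l => (hlim _).norm.pow 2) ?_
  filter_upwards [hdom ξ] with j hj l hl
  rw [← mul_pow]
  exact pow_le_pow_left₀ (norm_nonneg _) (hj l hl) 2

section Periodic

/-- The Fourier transform of `μ` is periodic with respect to the lattice `p ℤ^d`. -/
def IsFTPeriodic (μ : Measure (Rd d)) (p : Fin d → ℤ) : Prop :=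
  ∀ ξ k, ft μ (ξ + intVec (p * k)) = ft μ ξ

variable [IsProbabilityMeasure μ] {p : Fin d → ℤ} {Λ L : Finset (Fin d → ℤ)}

lemma IsParsevalSet.eq_of_add_mul_eq_add_mul (h : IsParsevalSet μ Λ) (hper : IsFTPeriodic μ p)
    {k l a b : Fin d → ℤ} (hk : k ∈ Λ) (hl : l ∈ Λ) (hkl : k + p * a = l + p * b) : k = l := by
  by_contra hne
  have hsub : k - l = 0 + p * (b - a) := by
    rw [mul_sub, zero_add, sub_eq_sub_iff_add_eq_add, hkl, add_comm]
  have hzero := h.ft_sub_eq_zero hk hl hne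
  rw [← intVec_sub, hsub, intVec_add, hper, intVec_zero, ft_zero] at hzero
  exact one_ne_zero hzero

lemma IsParsevalSet.image_add_mul (h : IsParsevalSet μ Λ) (hper : IsFTPeriodic μ p)
    (k : (Fin d → ℤ) → Fin d → ℤ) :
    IsParsevalSet μ (Λ.image fun l => l + p * k l : Finset (Fin d → ℤ)) := by
  refine isParsevalSet_coe.2 fun ξ => ?_
  rw [Finset.sum_image fun l hl l' hl' => h.eq_of_add_mul_eq_add_mul hper hl hl']
  simp_rw [intVec_add, ← add_assoc, hper _ (k _)]
  exact isParsevalSet_coe.1 h ξ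

lemma IsParsevalSet.image_product (hΛ : IsParsevalSet μ Λ) (hL : IsParsevalSet ν L)
    (hper : IsFTPeriodic μ p) (hp : ∀ i, p i ≠ 0)
    (hρ : ∀ ξ, ft ρ ξ = ft μ ξ * ft ν (scale p ξ)) :
    IsParsevalSet ρ ((Λ ×ˢ L).image fun q => q.1 + p * q.2 : Finset (Fin d → ℤ)) := by
  refine isParsevalSet_coe.2 fun ξ => ?_
  have hterm (l a : Fin d → ℤ) : ‖ft ρ (ξ + intVec (l + p * a))‖ ^ 2 =
      ‖ft μ (ξ + intVec l)‖ ^ 2 * ‖ft ν (scale p (ξ + intVec l) + intVec a)‖ ^ 2 := by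
    rw [hρ, norm_mul, mul_pow, intVec_add, ← add_assoc, hper, map_add (scale p) (ξ + intVec l),
      scale_mul_intVec hp]
  rw [Finset.sum_image, Finset.sum_product]
  · simp_rw [hterm, ← Finset.mul_sum, isParsevalSet_coe.1 hL, mul_one]
    exact isParsevalSet_coe.1 hΛ ξ
  · rintro ⟨l, a⟩ hl ⟨l', a'⟩ hl' heq
    obtain rfl := hΛ.eq_of_add_mul_eq_add_mul hper (Finset.mem_product.1 hl).1
      (Finset.mem_product.1 hl').1 heq
    congr 1
    funext i
    exact mul_left_cancel₀ (hp i) (congrFun (add_left_cancel heq) i)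

end Periodic

end Parseval

section DigitMeasure

variable {p : Fin d → ℤ} {B : Finset (Fin d → ℤ)}

/-- The measure `δ_{R⁻¹B}` of the diagonal matrix `R = diag(p)`. -/
def digitMeasure (p : Fin d → ℤ) (B : Finset (Fin d → ℤ)) : Measure (Rd d) :=
  (B.card : ENNReal)⁻¹ • ∑ b ∈ B, Measure.dirac (scale p (intVec b))

lemma isProbabilityMeasure_digitMeasure (hB : B.Nonempty) (p : Fin d → ℤ) :
    IsProbabilityMeasure (digitMeasure p B) := by
  refine ⟨?_⟩
  simp [digitMeasure, ENNReal.inv_mul_cancel, hB.ne_empty]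

lemma ft_digitMeasure (p : Fin d → ℤ) (B : Finset (Fin d → ℤ)) (ξ : Rd d) :
    ft (digitMeasure p B) ξ = (B.card : ℂ)⁻¹ * ∑ b ∈ B, wave ξ (scale p (intVec b)) := by
  rw [ft, digitMeasure, integral_smul_measure,
    integral_finsetSum_measure fun b _ => integrable_wave (Measure.dirac _) ξ, Complex.real_smul]
  simp

lemma ft_digitMeasure_mul (q p : Fin d → ℤ) (B : Finset (Fin d → ℤ)) (ξ : Rd d) :
    ft (digitMeasure (q * p) B) ξ = ft (digitMeasure p B) (scale q ξ) := by
  simp_rw [ft_digitMeasure, wave_scale, scale_scale]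

lemma isFTPeriodic_digitMeasure (hp : ∀ i, p i ≠ 0) (B : Finset (Fin d → ℤ)) :
    IsFTPeriodic (digitMeasure p B) p := fun ξ k => by
  simp_rw [ft_digitMeasure, wave_add_left, wave_scale p (intVec _), scale_mul_intVec hp,
    wave_intVec_intVec, mul_one]

lemma invApply_diagonal (hp : ∀ i, p i ≠ 0) (b : Fin d → ℤ) :
    invApply (Matrix.diagonal p) b = scale p (intVec b) := by
  have hinv : (realMat (Matrix.diagonal p))⁻¹ = Matrix.diagonal fun i => (p i : ℝ)⁻¹ := by
    refine Matrix.inv_eq_right_inv ?_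
    rw [realMat, Matrix.diagonal_map Int.cast_zero, Matrix.diagonal_mul_diagonal,
      ← Matrix.diagonal_one]
    exact congrArg _ (funext fun i => mul_inv_cancel₀ (Int.cast_ne_zero.2 (hp i)))
  ext i
  simp [invApply, hinv, Matrix.mulVec_diagonal, div_eq_inv_mul]

lemma unifMeasure_invImage_diagonal (hp : ∀ i, p i ≠ 0) (B : Finset (Fin d → ℤ)) :
    unifMeasure (invImage (Matrix.diagonal p) B) = digitMeasure p B := by
  have happly : invApply (Matrix.diagonal p) = fun b => scale p (intVec b) :=
    funext (invApply_diagonal hp)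
  have hinj := scale_intVec_injective hp
  rw [unifMeasure, invImage, happly, Finset.card_image_of_injective _ hinj,
    Finset.sum_image hinj.injOn, digitMeasure]

lemma star_dotProduct_self {ι : Type*} [Fintype ι] (v : ι → ℂ) :
    dotProduct (star v) v = ((∑ i, ‖v i‖ ^ 2 : ℝ) : ℂ) := by
  simp [dotProduct, Complex.conj_mul']

lemma sum_norm_sq_mulVec {m n : Type*} [Fintype m] [Fintype n] [DecidableEq n]
    {A : Matrix m n ℂ} (hA : A.conjTranspose * A = 1) (v : n → ℂ) :
    ∑ i, ‖A.mulVec v i‖ ^ 2 = ∑ j, ‖v j‖ ^ 2 := by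
  rw [← Complex.ofReal_inj, ← star_dotProduct_self, ← star_dotProduct_self, Matrix.star_mulVec,
    ← Matrix.dotProduct_mulVec, Matrix.mulVec_mulVec, hA, Matrix.one_mulVec]

lemma conjTranspose_hadamardMatrix_diagonal_apply (hp : ∀ i, p i ≠ 0) {L : Finset (Fin d → ℤ)}
    (l : L) (b : B) : (hadamardMatrix (Matrix.diagonal p) B L).conjTranspose l b =
      ((1 / √(B.card : ℝ) : ℝ) : ℂ) * wave (intVec l) (scale p (intVec b)) := by
  rw [Matrix.conjTranspose_apply, hadamardMatrix, Matrix.of_apply, star_mul', RCLike.star_def,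
    Complex.conj_ofReal, ← Complex.exp_conj, invApply_diagonal hp, wave_eq_exp,
    real_inner_comm]
  simp only [map_neg, map_mul, map_ofNat, Complex.conj_ofReal, Complex.conj_I, mul_neg, neg_mul,
    neg_neg]

theorem IsAdmissiblePair.exists_isParsevalSet (hp : ∀ i, p i ≠ 0) (hB : B.Nonempty)
    (h : IsAdmissiblePair (Matrix.diagonal p) B) :
    ∃ L : Finset (Fin d → ℤ), IsParsevalSet (digitMeasure p B) L := by
  obtain ⟨-, L, -, hH, -⟩ := h
  refine ⟨L, isParsevalSet_coe.2 fun ξ => ?_⟩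
  set H := hadamardMatrix (Matrix.diagonal p) B L
  set r : ℝ := 1 / √(B.card : ℝ)
  have hcard : (B.card : ℝ) ≠ 0 := by exact_mod_cast hB.card_ne_zero
  have hr : r ^ 2 = (B.card : ℝ)⁻¹ := by
    rw [div_pow, one_pow, Real.sq_sqrt (Nat.cast_nonneg _), one_div]
  let v : B → ℂ := fun b => r * wave ξ (scale p (intVec b))
  have hft (l : L) : ft (digitMeasure p B) (ξ + intVec l) = H.conjTranspose.mulVec v l := by
    rw [ft_digitMeasure, ← Complex.ofReal_natCast, ← Complex.ofReal_inv, ← hr, Finset.mul_sum,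
      ← Finset.sum_coe_sort]
    refine Finset.sum_congr rfl fun b _ => ?_
    change _ = H.conjTranspose l b * (r * wave ξ (scale p (intVec b)))
    rw [conjTranspose_hadamardMatrix_diagonal_apply hp, wave_add_left,
      Complex.ofReal_pow]
    ring
  have hiso : H.conjTranspose.conjTranspose * H.conjTranspose = 1 := by
    rw [Matrix.conjTranspose_conjTranspose, hH]
  calc ∑ l ∈ L, ‖ft (digitMeasure p B) (ξ + intVec l)‖ ^ 2
      = ∑ l, ‖H.conjTranspose.mulVec v l‖ ^ 2 := by
        rw [← Finset.sum_coe_sort]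
        exact Finset.sum_congr rfl fun l _ => by rw [hft]
    _ = ∑ b, ‖v b‖ ^ 2 := sum_norm_sq_mulVec hiso v
    _ = 1 := by simp [v, hr, hcard]

end DigitMeasure

/-- An element of the class `𝒟_d`, given by the diagonal of its matrix and its set of digits. -/
structure DigitSystem (d : ℕ) where
  m : Fin d → ℤ
  B : Finset (Fin d → ℤ)
  two_le : ∀ i, 2 ≤ m i
  nonempty : B.Nonempty
  nonneg : ∀ b ∈ B, ∀ i, 0 ≤ b i
  le_sub_one : ∀ b ∈ B, ∀ i, b i ≤ m i - 1

namespace DigitSystem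

instance (D : DigitSystem d) : Nonempty D.B := D.nonempty.coe_sort

lemma m_ne_zero (D : DigitSystem d) (i : Fin d) : D.m i ≠ 0 :=
  (zero_lt_two.trans_le (D.two_le i)).ne'

end DigitSystem

lemma MemD.exists_digitSystem {R : Matrix (Fin d) (Fin d) ℤ} {B : Finset (Fin d → ℤ)}
    (h : MemD R B) : ∃ D : DigitSystem d, R = Matrix.diagonal D.m ∧ B = D.B := by
  obtain ⟨m, hm, hR, hB, hdigit⟩ := h
  exact ⟨⟨m, B, hm, hB, fun b hb i => (hdigit b hb i).1, fun b hb i => (hdigit b hb i).2⟩, hR, rfl⟩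

section Base

/-- The diagonal of `R_{n-1} ⋯ R_0`. -/
def base (ω : ℕ → DigitSystem d) (n : ℕ) : Fin d → ℤ := ∏ k ∈ Finset.range n, (ω k).m

/-- The sequence of digit systems without its first `n` terms. -/
def shift (n : ℕ) (ω : ℕ → DigitSystem d) : ℕ → DigitSystem d := fun k => ω (n + k)

variable (ω : ℕ → DigitSystem d)

@[simp] lemma base_zero : base ω 0 = 1 := Finset.prod_range_zero _

lemma base_succ (n : ℕ) : base ω (n + 1) = base ω n * (ω n).m := Finset.prod_range_succ _ _

lemma base_add (n k : ℕ) : base ω (n + k) = base ω n * base (shift n ω) k :=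
  Finset.prod_range_add _ _ _

lemma two_pow_le_base (n : ℕ) (i : Fin d) : (2 : ℝ) ^ n ≤ base ω n i := by
  rw [base, Finset.prod_apply, Int.cast_prod, ← Finset.card_range n, ← Finset.prod_const,
    Finset.card_range]
  exact Finset.prod_le_prod (fun _ _ => zero_le_two) fun k _ => by exact_mod_cast (ω k).two_le i

lemma base_pos (n : ℕ) (i : Fin d) : (0 : ℝ) < base ω n i :=
  (pow_pos two_pos n).trans_le (two_pow_le_base ω n i)

lemma base_ne_zero (n : ℕ) (i : Fin d) : base ω n i ≠ 0 := by
  exact_mod_cast (base_pos ω n i).ne'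

lemma one_div_base_le (n : ℕ) (i : Fin d) : 1 / (base ω n i : ℝ) ≤ (1 / 2) ^ n := by
  rw [one_div_pow]
  exact one_div_le_one_div_of_le (by positivity) (two_pow_le_base ω n i)

lemma tendsto_one_div_base (i : Fin d) :
    Tendsto (fun n => 1 / (base ω n i : ℝ)) atTop (𝓝 0) :=
  squeeze_zero (fun n => (one_div_pos.2 (base_pos ω n i)).le) (fun n => one_div_base_le ω n i)
    (tendsto_pow_atTop_nhds_zero_of_lt_one (by norm_num) (by norm_num))

lemma one_div_base_sub_one_div_base_succ (n : ℕ) (i : Fin d) :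
    1 / (base ω n i : ℝ) - 1 / base ω (n + 1) i = (((ω n).m i : ℝ) - 1) / base ω (n + 1) i := by
  have hbase := (base_pos ω n i).ne'
  have hm : ((ω n).m i : ℝ) ≠ 0 := Int.cast_ne_zero.2 ((ω n).m_ne_zero i)
  rw [base_succ, Pi.mul_apply, Int.cast_mul]
  field_simp

lemma tendsto_scale_base (ξ : Rd d) :
    Tendsto (fun n => scale (base ω n) ξ) atTop (𝓝 0) := by
  have hcoord : Tendsto (fun n i => ξ i / base ω n i) atTop (𝓝 (0 : Fin d → ℝ)) :=
    tendsto_pi_nhds.2 fun i => by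
      simpa [div_eq_mul_inv] using (tendsto_one_div_base ω i).const_mul (ξ i)
  exact ((PiLp.continuous_toLp 2 fun _ : Fin d => ℝ).tendsto 0).comp hcoord

end Base

section PathSum

/-- A choice of one digit from each digit system. -/
abbrev Path (ω : ℕ → DigitSystem d) : Type := ∀ k, (ω k).B

variable (ω : ℕ → DigitSystem d)

/-- The vector `(R_k ⋯ R_0)⁻¹ b`. -/
def digitVec (k : ℕ) (b : Fin d → ℤ) : Rd d := scale (base ω (k + 1)) (intVec b)

/-- The sum `∑_{k < N} (R_k ⋯ R_0)⁻¹ b_k`. -/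
def partialSum (N : ℕ) (b : Path ω) : Rd d := ∑ k ∈ Finset.range N, digitVec ω k (b k)

/-- The sum `∑_k (R_k ⋯ R_0)⁻¹ b_k`, taken coordinatewise. -/
def pathSum (b : Path ω) : Rd d := WithLp.toLp 2 fun i => ∑' k, digitVec ω k (b k) i

lemma digitVec_apply (k : ℕ) (b : Fin d → ℤ) (i : Fin d) :
    digitVec ω k b i = b i / base ω (k + 1) i := rfl

lemma partialSum_apply (N : ℕ) (b : Path ω) (i : Fin d) :
    partialSum ω N b i = ∑ k ∈ Finset.range N, digitVec ω k (b k) i := by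
  simp [partialSum]

lemma partialSum_succ (N : ℕ) (b : Path ω) :
    partialSum ω (N + 1) b = partialSum ω N b + digitVec ω N (b N) :=
  Finset.sum_range_succ _ _

lemma digitVec_nonneg (b : Path ω) (i : Fin d) (k : ℕ) : 0 ≤ digitVec ω k (b k) i :=
  div_nonneg (Int.cast_nonneg ((ω k).nonneg _ (b k).2 i)) (base_pos ω _ i).le

lemma digitVec_le (b : Path ω) (i : Fin d) (k : ℕ) :
    digitVec ω k (b k) i ≤ 1 / base ω k i - 1 / base ω (k + 1) i := by
  have hdigit : ((b k).1 i : ℝ) ≤ (ω k).m i - 1 := by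
    exact_mod_cast (ω k).le_sub_one _ (b k).2 i
  rw [one_div_base_sub_one_div_base_succ]
  exact div_le_div_of_nonneg_right hdigit (base_pos ω (k + 1) i).le

lemma sum_one_div_base_sub (N : ℕ) (i : Fin d) :
    ∑ k ∈ Finset.range N, (1 / (base ω k i : ℝ) - 1 / base ω (k + 1) i) = 1 - 1 / base ω N i := by
  rw [Finset.sum_range_sub' fun k => 1 / (base ω k i : ℝ)]
  simp

lemma hasSum_one_div_base_sub (i : Fin d) :
    HasSum (fun k => 1 / (base ω k i : ℝ) - 1 / base ω (k + 1) i) 1 := by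
  have hnonneg (k : ℕ) : 0 ≤ 1 / (base ω k i : ℝ) - 1 / base ω (k + 1) i := by
    have b : Path ω := fun _ => Classical.arbitrary _
    exact (digitVec_nonneg ω b i k).trans (digitVec_le ω b i k)
  rw [hasSum_iff_tendsto_nat_of_nonneg hnonneg]
  simp_rw [sum_one_div_base_sub]
  simpa using (tendsto_one_div_base ω i).const_sub 1

lemma hasSum_pathSum (b : Path ω) (i : Fin d) :
    HasSum (fun k => digitVec ω k (b k) i) (pathSum ω b i) :=
  (Summable.of_nonneg_of_le (digitVec_nonneg ω b i) (digitVec_le ω b i)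
    (hasSum_one_div_base_sub ω i).summable).hasSum

lemma hasSum_one_sub_pathSum (b : Path ω) (i : Fin d) :
    HasSum (fun k => 1 / (base ω k i : ℝ) - 1 / base ω (k + 1) i - digitVec ω k (b k) i)
      (1 - pathSum ω b i) :=
  (hasSum_one_div_base_sub ω i).sub (hasSum_pathSum ω b i)

lemma partialSum_le_pathSum (N : ℕ) (b : Path ω) (i : Fin d) :
    partialSum ω N b i ≤ pathSum ω b i := by
  rw [partialSum_apply]
  exact sum_le_hasSum _ (fun k _ => digitVec_nonneg ω b i k) (hasSum_pathSum ω b i)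

lemma pathSum_le_partialSum_add (N : ℕ) (b : Path ω) (i : Fin d) :
    pathSum ω b i ≤ partialSum ω N b i + 1 / base ω N i := by
  have hsum := sum_le_hasSum (Finset.range N) (fun k _ => sub_nonneg.2 (digitVec_le ω b i k))
    (hasSum_one_sub_pathSum ω b i)
  rw [Finset.sum_sub_distrib, sum_one_div_base_sub, ← partialSum_apply] at hsum
  linarith

lemma norm_partialSum_sub_pathSum_le (N : ℕ) (b : Path ω) :
    ‖partialSum ω N b - pathSum ω b‖ ≤ √d * (1 / 2) ^ N := by
  have hpow : (0 : ℝ) ≤ (1 / 2) ^ N := by positivity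
  rw [← abs_of_nonneg hpow]
  refine norm_le_sqrt_mul fun i => ?_
  rw [PiLp.sub_apply, abs_le]
  constructor <;> linarith [partialSum_le_pathSum ω N b i, pathSum_le_partialSum_add ω N b i,
    one_div_base_le ω N i]

lemma tendsto_partialSum (b : Path ω) :
    Tendsto (fun N => partialSum ω N b) atTop (𝓝 (pathSum ω b)) := by
  refine tendsto_iff_norm_sub_tendsto_zero.2 <| squeeze_zero (fun _ => norm_nonneg _)
    (fun N => norm_partialSum_sub_pathSum_le ω N b) ?_
  simpa using (tendsto_pow_atTop_nhds_zero_of_lt_one (by norm_num : (0 : ℝ) ≤ 1 / 2)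
    (by norm_num)).const_mul (√d)

lemma pathSum_mem_Icc (b : Path ω) (i : Fin d) : pathSum ω b i ∈ Set.Icc (0 : ℝ) 1 :=
  ⟨by simpa [partialSum] using partialSum_le_pathSum ω 0 b i,
    by simpa [partialSum] using pathSum_le_partialSum_add ω 0 b i⟩

lemma norm_pathSum_le (b : Path ω) : ‖pathSum ω b‖ ≤ √d := by
  simpa [partialSum] using norm_partialSum_sub_pathSum_le ω 0 b

lemma digit_eq_zero_of_pathSum_eq_zero {b : Path ω} {i : Fin d} (h : pathSum ω b i = 0) (k : ℕ) :
    (b k).1 i = 0 := by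
  have hsum := hasSum_pathSum ω b i
  rw [h, hasSum_zero_iff_of_nonneg (digitVec_nonneg ω b i)] at hsum
  have hk : ((b k).1 i : ℝ) / base ω (k + 1) i = 0 := congrFun hsum k
  exact_mod_cast (div_eq_zero_iff.1 hk).resolve_right (base_pos ω (k + 1) i).ne'

lemma digit_eq_sub_one_of_pathSum_eq_one {b : Path ω} {i : Fin d} (h : pathSum ω b i = 1) (k : ℕ) :
    (b k).1 i = (ω k).m i - 1 := by
  have hsum := hasSum_one_sub_pathSum ω b i
  rw [h, sub_self, hasSum_zero_iff_of_nonneg fun k => sub_nonneg.2 (digitVec_le ω b i k)] at hsum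
  have hk := sub_eq_zero.1 (congrFun hsum k)
  rw [one_div_base_sub_one_div_base_succ, digitVec_apply,
    div_left_inj' (base_pos ω (k + 1) i).ne'] at hk
  exact_mod_cast hk.symm

end PathSum

section OppositeFaces

lemma measure_mul_measure_le_of_disjoint {α : Type*} [MeasurableSpace α] (μ : Measure α)
    [IsProbabilityMeasure μ] {s t : Set α} (hst : Disjoint s t) (ht : MeasurableSet t) :
    μ s * μ t ≤ 1 / 4 := by
  have hsum : μ.real s + μ.real t ≤ 1 := by
    rw [← measureReal_union hst ht]
    exact measureReal_le_one
  have hprod : μ.real s * μ.real t ≤ 1 / 4 := by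
    nlinarith [sq_nonneg (μ.real s - μ.real t), measureReal_nonneg (μ := μ) (s := s),
      measureReal_nonneg (μ := μ) (s := t)]
  rw [← ofReal_measureReal, ← ofReal_measureReal, ← ENNReal.ofReal_mul measureReal_nonneg]
  refine (ENNReal.ofReal_le_ofReal hprod).trans_eq ?_
  rw [ENNReal.ofReal_div_of_pos four_pos]
  simp

lemma infinitePi_pi_mul_infinitePi_pi_eq_zero {X : ℕ → Type*} [∀ k, MeasurableSpace (X k)]
    (μ : ∀ k, Measure (X k)) [∀ k, IsProbabilityMeasure (μ k)] {S T : ∀ k, Set (X k)}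
    (hS : ∀ k, MeasurableSet (S k)) (hT : ∀ k, MeasurableSet (T k))
    (hST : ∀ k, Disjoint (S k) (T k)) :
    Measure.infinitePi μ (Set.univ.pi S) * Measure.infinitePi μ (Set.univ.pi T) = 0 := by
  have hle {U : ∀ k, Set (X k)} (hU : ∀ k, MeasurableSet (U k)) (N : ℕ) :
      Measure.infinitePi μ (Set.univ.pi U) ≤ ∏ k ∈ Finset.range N, μ k (U k) := by
    rw [← Measure.infinitePi_pi _ fun k _ => hU k]
    exact measure_mono (Set.pi_mono' (fun _ _ => Set.Subset.rfl) (Set.subset_univ _))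
  refine nonpos_iff_eq_zero.1 (ge_of_tendsto' (ENNReal.tendsto_pow_atTop_nhds_zero_of_lt_one
    (r := 1 / 4) (by norm_num)) fun N => ?_)
  calc _ ≤ (∏ k ∈ Finset.range N, μ k (S k)) * ∏ k ∈ Finset.range N, μ k (T k) :=
        mul_le_mul' (hle hS N) (hle hT N)
    _ = ∏ k ∈ Finset.range N, μ k (S k) * μ k (T k) := Finset.prod_mul_distrib.symm
    _ ≤ ∏ _k ∈ Finset.range N, 1 / 4 :=
        Finset.prod_le_prod' fun k _ => measure_mul_measure_le_of_disjoint _ (hST k) (hT k)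
    _ = (1 / 4) ^ N := by simp

end OppositeFaces

section Law

open ProbabilityTheory

lemma map_uniformOn_univ {α β : Type*} [MeasurableSpace α] [MeasurableSingletonClass α]
    [MeasurableSpace β] (B : Finset α) (f : α → β) :
    (uniformOn (Set.univ : Set B)).map (fun b : B => f b) =
      (B.card : ENNReal)⁻¹ • ∑ b ∈ B, Measure.dirac (f b) := by
  have hf : Measurable fun b : B => f b := measurable_of_countable _
  rw [uniformOn, ProbabilityTheory.cond, Measure.restrict_univ, Measure.map_smul,
    Measure.count_univ, Measure.count, Measure.map_sum hf.aemeasurable]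
  simp only [Measure.map_dirac' hf, Measure.sum_fintype, ENat.card_eq_coe_fintype_card,
    Fintype.card_coe, ENat.toENNReal_coe]
  rw [Finset.sum_coe_sort B fun b => Measure.dirac (f b)]

variable (ω : ℕ → DigitSystem d)

/-- The law of a sequence of independent digits, each uniformly distributed. -/
def pathMeasure : Measure (Path ω) :=
  Measure.infinitePi fun k => uniformOn (Set.univ : Set (ω k).B)

instance : IsProbabilityMeasure (pathMeasure ω) := by
  unfold pathMeasure
  infer_instance

lemma measurable_digitVec (k : ℕ) : Measurable fun b : Path ω => digitVec ω k (b k) :=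
  (measurable_of_countable fun b : (ω k).B => digitVec ω k b).comp (measurable_pi_apply k)

lemma measurable_partialSum (N : ℕ) : Measurable (partialSum ω N) :=
  Finset.measurable_fun_sum _ fun k _ => measurable_digitVec ω k

lemma measurable_pathSum : Measurable (pathSum ω) :=
  measurable_of_tendsto_metrizable (measurable_partialSum ω)
    (tendsto_pi_nhds.2 (tendsto_partialSum ω))

/-- The law of the sum of the first `n` terms: the measure `μ_n` of the theorem. -/
def partialLaw (n : ℕ) : Measure (Rd d) := (pathMeasure ω).map (partialSum ω n)

/-- The law of the whole random series: the infinite convolution `μ` of the theorem. -/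
def law : Measure (Rd d) := (pathMeasure ω).map (pathSum ω)

instance (n : ℕ) : IsProbabilityMeasure (partialLaw ω n) :=
  Measure.isProbabilityMeasure_map (measurable_partialSum ω n).aemeasurable

instance : IsProbabilityMeasure (law ω) :=
  Measure.isProbabilityMeasure_map (measurable_pathSum ω).aemeasurable

lemma map_digitVec (k : ℕ) :
    (pathMeasure ω).map (fun b => digitVec ω k (b k)) =
      digitMeasure (base ω (k + 1)) (ω k).B := by
  have hmap := Measure.map_map (μ := pathMeasure ω)
    (measurable_of_countable fun b : (ω k).B => digitVec ω k b) (measurable_pi_apply k)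
  rw [pathMeasure, Measure.infinitePi_map_eval, map_uniformOn_univ] at hmap
  exact hmap.symm

lemma indepFun_partialSum_digitVec (n : ℕ) :
    IndepFun (partialSum ω n) (fun b => digitVec ω n (b n)) (pathMeasure ω) := by
  have hindep : iIndepFun (fun k (b : Path ω) => digitVec ω k (b k)) (pathMeasure ω) :=
    iIndepFun_infinitePi (X := fun k (b : (ω k).B) => digitVec ω k b)
      fun _ => measurable_of_countable _
  have hsum : partialSum ω n = ∑ k ∈ Finset.range n, fun b : Path ω => digitVec ω k (b k) := by
    funext b
    simp [partialSum]
  rw [hsum]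
  exact hindep.indepFun_finsetSum_of_notMem (measurable_digitVec ω) Finset.notMem_range_self

lemma partialLaw_zero : partialLaw ω 0 = Measure.dirac 0 := by
  have hzero : partialSum ω 0 = fun _ => 0 := funext fun _ => Finset.sum_range_zero _
  rw [partialLaw, hzero, Measure.map_const, measure_univ, one_smul]

lemma partialLaw_succ (n : ℕ) :
    partialLaw ω (n + 1) = (partialLaw ω n).conv (digitMeasure (base ω (n + 1)) (ω n).B) := by
  rw [partialLaw, partialLaw, ← map_digitVec, ← (indepFun_partialSum_digitVec ω n)
    |>.map_add_eq_map_conv_map (measurable_partialSum ω n) (measurable_digitVec ω n)]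
  exact congrArg (Measure.map · _) (funext (partialSum_succ ω n))

lemma partialConv_eq_partialLaw (n : ℕ) :
    partialConv (fun n => Matrix.diagonal (ω n).m) (fun n => (ω n).B) n = partialLaw ω n := by
  have hprod (n : ℕ) :
      prodMat (fun n => Matrix.diagonal (ω n).m) n = Matrix.diagonal (base ω n) := by
    induction n with
    | zero => rw [prodMat, base_zero, ← Matrix.diagonal_one]; rfl
    | succ n ih =>
      rw [prodMat, ih, Matrix.diagonal_mul_diagonal, base_succ, mul_comm (base ω n)]
      rfl
  induction n with
  | zero => rw [partialConv, partialLaw_zero]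
  | succ n ih =>
    rw [partialConv, ih, hprod, unifMeasure_invImage_diagonal (base_ne_zero ω _), partialLaw_succ]

theorem isInfiniteConvolution_law :
    IsInfiniteConvolution (fun n => Matrix.diagonal (ω n).m) (fun n => (ω n).B) (law ω) := by
  refine ⟨inferInstance, fun f => ?_⟩
  have hmeas (ν : Measure (Rd d)) : AEStronglyMeasurable f ν := f.continuous.aestronglyMeasurable
  have hpartial (n : ℕ) : ∫ x, f x ∂(partialLaw ω n) = ∫ b, f (partialSum ω n b) ∂(pathMeasure ω) :=
    integral_map (measurable_partialSum ω n).aemeasurable (hmeas _)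
  have hlaw : ∫ x, f x ∂(law ω) = ∫ b, f (pathSum ω b) ∂(pathMeasure ω) :=
    integral_map (measurable_pathSum ω).aemeasurable (hmeas _)
  simp_rw [partialConv_eq_partialLaw, hpartial, hlaw]
  exact tendsto_integral_of_dominated_convergence (fun _ => ‖f‖)
    (fun n => (f.continuous.measurable.comp (measurable_partialSum ω n)).aestronglyMeasurable)
    (integrable_const _) (fun n => .of_forall fun b => f.norm_coe_le_norm _)
    (.of_forall fun b => (f.continuous.tendsto _).comp (tendsto_partialSum ω b))

lemma ae_law {q : Rd d → Prop} (hq : MeasurableSet {x | q x}) (h : ∀ b, q (pathSum ω b)) :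
    ∀ᵐ x ∂(law ω), q x :=
  (ae_map_iff (measurable_pathSum ω).aemeasurable hq).2 (.of_forall h)

lemma law_face (i : Fin d) : law ω {x | x i = 0} = 0 ∨ law ω {x | x i = 1} = 0 := by
  have hcoord : Measurable fun x : Rd d => x i := (PiLp.continuous_apply 2 _ i).measurable
  have hface (c : ℝ) : law ω {x | x i = c} = pathMeasure ω {b | pathSum ω b i = c} :=
    Measure.map_apply (measurable_pathSum ω) (hcoord (measurableSet_singleton c))
  let S (k : ℕ) : Set (ω k).B := {b | b.1 i = 0}
  let T (k : ℕ) : Set (ω k).B := {b | b.1 i = (ω k).m i - 1}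
  have hST (k : ℕ) : Disjoint (S k) (T k) :=
    Set.disjoint_left.2 fun b (hS : b.1 i = 0) (hT : b.1 i = _) => by
      have := (ω k).two_le i
      lia
  have hzero := infinitePi_pi_mul_infinitePi_pi_eq_zero
    (fun k => uniformOn (Set.univ : Set (ω k).B)) (fun k => (S k).to_countable.measurableSet)
    (fun k => (T k).to_countable.measurableSet) hST
  rw [hface, hface]
  have hzeros : {b | pathSum ω b i = 0} ⊆ Set.univ.pi S :=
    fun b hb k _ => digit_eq_zero_of_pathSum_eq_zero ω hb k
  have hones : {b | pathSum ω b i = 1} ⊆ Set.univ.pi T :=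
    fun b hb k _ => digit_eq_sub_one_of_pathSum_eq_one ω hb k
  exact (mul_eq_zero.1 hzero).imp (measure_mono_null hzeros) (measure_mono_null hones)

theorem integralWavesTotal_law : IntegralWavesTotal (law ω) := by
  refine integralWavesTotal_of_unitCube (ae_law ω ?_ (pathSum_mem_Icc ω)) (law_face ω)
  measurability

end Law

section LawFourier

variable (ω : ℕ → DigitSystem d)

lemma norm_ft_law_sub_le (ξ η : Rd d) :
    ‖ft (law ω) ξ - ft (law ω) η‖ ≤ 2 * Real.pi * √d * ‖ξ - η‖ :=
  norm_ft_sub_le (ae_law ω (measurableSet_le measurable_norm measurable_const)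
    (norm_pathSum_le ω)) ξ η

lemma norm_ft_partialLaw_sub_ft_law_le (N : ℕ) (ξ : Rd d) :
    ‖ft (partialLaw ω N) ξ - ft (law ω) ξ‖ ≤ 2 * Real.pi * ‖ξ‖ * (√d * (1 / 2) ^ N) :=
  norm_ft_map_sub_ft_map_le _ (measurable_partialSum ω N).aemeasurable
    (measurable_pathSum ω).aemeasurable
    (.of_forall fun b => norm_partialSum_sub_pathSum_le ω N b) ξ

lemma tendsto_tail_bound (C : ℝ) :
    Tendsto (fun N : ℕ => C * (√d * (1 / 2) ^ N)) atTop (𝓝 0) := by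
  simpa using ((tendsto_pow_atTop_nhds_zero_of_lt_one (by norm_num : (0 : ℝ) ≤ 1 / 2)
    (by norm_num)).const_mul (√d)).const_mul C

lemma tendsto_ft_partialLaw (ξ : Rd d) :
    Tendsto (fun N => ft (partialLaw ω N) ξ) atTop (𝓝 (ft (law ω) ξ)) :=
  tendsto_iff_norm_sub_tendsto_zero.2 <| squeeze_zero (fun _ => norm_nonneg _)
    (fun N => norm_ft_partialLaw_sub_ft_law_le ω N ξ) (tendsto_tail_bound _)

lemma ft_partialLaw_succ (n : ℕ) (ξ : Rd d) :
    ft (partialLaw ω (n + 1)) ξ =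
      ft (partialLaw ω n) ξ * ft (digitMeasure (ω n).m (ω n).B) (scale (base ω n) ξ) := by
  have := isProbabilityMeasure_digitMeasure (ω n).nonempty (base ω (n + 1))
  rw [partialLaw_succ, ft_conv, base_succ, ft_digitMeasure_mul]

lemma ft_partialLaw (n : ℕ) (ξ : Rd d) :
    ft (partialLaw ω n) ξ =
      ∏ k ∈ Finset.range n, ft (digitMeasure (ω k).m (ω k).B) (scale (base ω k) ξ) := by
  induction n with
  | zero => simp [partialLaw_zero, ft]
  | succ n ih => rw [ft_partialLaw_succ, ih, Finset.prod_range_succ]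

lemma ft_partialLaw_add (n N : ℕ) (ξ : Rd d) :
    ft (partialLaw ω (n + N)) ξ =
      ft (partialLaw ω n) ξ * ft (partialLaw (shift n ω) N) (scale (base ω n) ξ) := by
  simp_rw [ft_partialLaw, Finset.prod_range_add, scale_scale, base_add]
  rfl

lemma ft_law_eq_mul (n : ℕ) (ξ : Rd d) :
    ft (law ω) ξ = ft (partialLaw ω n) ξ * ft (law (shift n ω)) (scale (base ω n) ξ) := by
  have hshift := (tendsto_add_atTop_iff_nat n).2 (tendsto_ft_partialLaw ω ξ)
  simp_rw [add_comm _ n, ft_partialLaw_add] at hshift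
  exact tendsto_nhds_unique hshift ((tendsto_ft_partialLaw _ _).const_mul _)

lemma isFTPeriodic_partialLaw (n : ℕ) : IsFTPeriodic (partialLaw ω n) (base ω n) := by
  induction n with
  | zero => simp [IsFTPeriodic, partialLaw_zero, ft]
  | succ n ih =>
    have := isProbabilityMeasure_digitMeasure (ω n).nonempty (base ω (n + 1))
    intro ξ k
    rw [partialLaw_succ, ft_conv, ft_conv, isFTPeriodic_digitMeasure (base_ne_zero ω _), base_succ,
      mul_assoc, ih]

end LawFourier

section EquiPositive

/-- Equi-positivity of a family of measures: their Fourier transforms are bounded below near `0`,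
and, uniformly in the family and in `ξ`, near some integral translate of each `ξ`. -/
def IsEquiPositive (𝓜 : Set (Measure (Rd d))) : Prop :=
  ∃ ε > 0, ∃ δ > 0, ∀ μ ∈ 𝓜, (∀ y, ‖y‖ < δ → ε ≤ ‖ft μ y‖) ∧
    ∀ ξ, ∃ k, ∀ y, ‖y‖ < δ → ε ≤ ‖ft μ (ξ + intVec k + y)‖

lemma IsEquiPositive.mono {𝓜 𝓜' : Set (Measure (Rd d))} (h : IsEquiPositive 𝓜') (hsub : 𝓜 ⊆ 𝓜') :
    IsEquiPositive 𝓜 := by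
  obtain ⟨ε, hε, δ, hδ, hlower⟩ := h
  exact ⟨ε, hε, δ, hδ, fun μ hμ => hlower μ (hsub hμ)⟩

lemma isEquiPositive_of_forall_exists_le {𝓜 : Set (Measure (Rd d))} {C ε : ℝ} (hC : 0 ≤ C)
    (hlip : ∀ μ ∈ 𝓜, ∀ ξ η, ‖ft μ ξ - ft μ η‖ ≤ C * ‖ξ - η‖) (hε : 0 < ε)
    (hzero : ∀ μ ∈ 𝓜, ε ≤ ‖ft μ 0‖) (hlower : ∀ μ ∈ 𝓜, ∀ ξ, ∃ k, ε ≤ ‖ft μ (ξ + intVec k)‖) :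
    IsEquiPositive 𝓜 := by
  have hCpos : 0 < C + 1 := by positivity
  have hmove {μ : Measure (Rd d)} (hμ : μ ∈ 𝓜) {ξ y : Rd d} (hξ : ε ≤ ‖ft μ ξ‖)
      (hy : ‖y‖ < ε / 2 / (C + 1)) : ε / 2 ≤ ‖ft μ (ξ + y)‖ := by
    have hdist : ‖ft μ ξ - ft μ (ξ + y)‖ ≤ C * ‖y‖ := by
      simpa only [sub_add_cancel_left, norm_neg] using hlip μ hμ ξ (ξ + y)
    have hsmall := (lt_div_iff₀' hCpos).1 hy
    have htriangle := norm_sub_norm_le (ft μ ξ) (ft μ (ξ + y))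
    nlinarith [norm_nonneg y]
  refine ⟨ε / 2, half_pos hε, ε / 2 / (C + 1), by positivity, fun μ hμ => ⟨fun y hy => ?_,
    fun ξ => (hlower μ hμ ξ).imp fun k hk y hy => hmove hμ hk hy⟩⟩
  simpa only [zero_add] using hmove hμ (hzero μ hμ) hy

lemma exists_pos_forall_exists_le_of_isCompact {X ι : Type*} [TopologicalSpace X] {K : Set X}
    (hK : IsCompact K) {f : ι → X → ℝ} (hf : ∀ i, Continuous (f i))
    (hpos : ∀ x ∈ K, ∃ i, 0 < f i x) : ∃ ε > 0, ∀ x ∈ K, ∃ i, ε ≤ f i x := by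
  refine hK.induction_on (p := fun s => ∃ ε > 0, ∀ x ∈ s, ∃ i, ε ≤ f i x) ⟨1, one_pos, by simp⟩
    ?_ ?_ ?_
  · rintro s t hst ⟨ε, hε, ht⟩
    exact ⟨ε, hε, fun x hx => ht x (hst hx)⟩
  · rintro s t ⟨ε, hε, hs⟩ ⟨ε', hε', ht⟩
    refine ⟨min ε ε', lt_min hε hε', fun x hx => hx.elim (fun hx => ?_) fun hx => ?_⟩
    · exact (hs x hx).imp fun i => (min_le_left ε ε').trans
    · exact (ht x hx).imp fun i => (min_le_right ε ε').trans
  · intro x hx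
    obtain ⟨i, hi⟩ := hpos x hx
    have hnhds : {y | f i x / 2 < f i y} ∈ 𝓝 x :=
      (hf i).continuousAt.eventually_const_lt (half_lt_self hi)
    exact ⟨_, mem_nhdsWithin_of_mem_nhds hnhds, f i x / 2, half_pos hi, fun y hy => ⟨i, hy.le⟩⟩

lemma exists_norm_add_intVec_le (ξ : Rd d) : ∃ k, ‖ξ + intVec k‖ ≤ √d := by
  refine ⟨fun i => -⌊ξ i⌋, ?_⟩
  have hfract (i : Fin d) : |(ξ + intVec fun i => -⌊ξ i⌋) i| ≤ 1 := by
    have hi : (ξ + intVec fun i => -⌊ξ i⌋) i = Int.fract (ξ i) := by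
      simp [intVec_apply, Int.fract, sub_eq_add_neg]
    rw [hi, Int.abs_fract]
    exact (Int.fract_lt_one _).le
  simpa only [abs_one, mul_one] using norm_le_sqrt_mul hfract

end EquiPositive

section Compactness

instance : TopologicalSpace (DigitSystem d) := ⊥

instance : DiscreteTopology (DigitSystem d) := ⟨rfl⟩

lemma finite_setOf_digitSystem_le (C : Fin d → ℤ) : {D : DigitSystem d | D.m ≤ C}.Finite := by
  have hinj : Function.Injective fun D : DigitSystem d => (D.m, D.B) := by
    rintro ⟨m, B, _, _, _, _⟩ ⟨m', B', _, _, _, _⟩ h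
    obtain ⟨rfl, rfl⟩ := Prod.mk.injEq .. ▸ h
    rfl
  refine Set.Finite.of_finite_image (Set.Finite.subset
    (Finset.Icc 0 C ×ˢ (Finset.Icc 0 C).powerset).finite_toSet ?_) hinj.injOn
  rintro _ ⟨D, hD, rfl⟩
  rw [Finset.mem_coe, Finset.mem_product, Finset.mem_powerset]
  refine ⟨Finset.mem_Icc.2 ⟨fun i => zero_le_two.trans (D.two_le i), hD⟩, fun b hb =>
    Finset.mem_Icc.2 ⟨D.nonneg b hb, fun i => ?_⟩⟩
  exact (D.le_sub_one b hb i).trans ((sub_one_lt _).le.trans (hD i))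

lemma continuous_base (n : ℕ) : Continuous fun ω : ℕ → DigitSystem d => base ω n :=
  continuous_finsetProd _ fun k _ => continuous_of_discreteTopology.comp (continuous_apply k)

lemma continuous_scale_base (n : ℕ) :
    Continuous fun q : (ℕ → DigitSystem d) × Rd d => scale (base q.1 n) q.2 := by
  have hcoord (i : Fin d) :
      Continuous fun q : (ℕ → DigitSystem d) × Rd d => q.2 i / (base q.1 n i : ℝ) := by
    have hbase : Continuous fun q : (ℕ → DigitSystem d) × Rd d => (base q.1 n i : ℝ) :=
      (continuous_of_discreteTopology (f := fun z : ℤ => (z : ℝ))).comp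
        ((continuous_apply i).comp ((continuous_base n).comp continuous_fst))
    have hnum : Continuous fun q : (ℕ → DigitSystem d) × Rd d => q.2 i := by fun_prop
    exact hnum.div hbase fun q => (base_pos q.1 n i).ne'
  exact (PiLp.continuous_toLp 2 fun _ : Fin d => ℝ).comp (continuous_pi hcoord)

lemma continuous_ft_digitMeasure :
    Continuous fun q : DigitSystem d × Rd d => ft (digitMeasure q.1.m q.1.B) q.2 := by
  refine continuous_prod_of_discrete_left.2 fun D => ?_
  have := isProbabilityMeasure_digitMeasure D.nonempty D.m
  simp_rw [ft_eq_charFun]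
  exact continuous_charFun.comp (continuous_const_smul _)

lemma continuous_ft_partialLaw (n : ℕ) :
    Continuous fun q : (ℕ → DigitSystem d) × Rd d => ft (partialLaw q.1 n) q.2 := by
  have hpair (k : ℕ) :
      Continuous fun q : (ℕ → DigitSystem d) × Rd d => (q.1 k, scale (base q.1 k) q.2) :=
    ((continuous_apply k).comp continuous_fst).prodMk (continuous_scale_base k)
  have hfactor (k : ℕ) := continuous_ft_digitMeasure.comp (hpair k)
  exact (continuous_finsetProd (Finset.range n) fun k _ => hfactor k).congr
    fun q => (ft_partialLaw q.1 n q.2).symm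

lemma continuous_ft_law :
    Continuous fun q : (ℕ → DigitSystem d) × Rd d => ft (law q.1) q.2 := by
  have hlim : TendstoLocallyUniformly (fun n (q : (ℕ → DigitSystem d) × Rd d) =>
      ft (partialLaw q.1 n) q.2) (fun q => ft (law q.1) q.2) atTop := by
    refine Metric.tendstoLocallyUniformly_iff.2 fun ε hε q => ?_
    have hbounded : {r : (ℕ → DigitSystem d) × Rd d | ‖r.2‖ < ‖q.2‖ + 1} ∈ 𝓝 q :=
      continuous_snd.norm.continuousAt.eventually_lt_const (lt_add_one _)
    have htail := (tendsto_tail_bound (d := d) (2 * Real.pi * (‖q.2‖ + 1))).eventually_lt_const hε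
    refine ⟨_, hbounded, htail.mono fun n hn r hr => ?_⟩
    rw [dist_comm, dist_eq_norm]
    refine (norm_ft_partialLaw_sub_ft_law_le r.1 n r.2).trans_lt (lt_of_le_of_lt ?_ hn)
    have hr : ‖r.2‖ ≤ ‖q.2‖ + 1 := le_of_lt hr
    gcongr
  exact hlim.continuous (.of_forall continuous_ft_partialLaw)

theorem isEquiPositive_law (C : Fin d → ℤ) :
    IsEquiPositive (law '' {ω : ℕ → DigitSystem d | ∀ n, (ω n).m ≤ C}) := by
  have hK : IsCompact ((Set.univ.pi fun _ : ℕ => {D : DigitSystem d | D.m ≤ C}) ×ˢ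
      Metric.closedBall (0 : Rd d) (√d)) :=
    (isCompact_univ_pi fun _ => (finite_setOf_digitSystem_le C).isCompact).prod
      (isCompact_closedBall _ _)
  have hcont (k : Fin d → ℤ) :
      Continuous fun q : (ℕ → DigitSystem d) × Rd d => ‖ft (law q.1) (q.2 + intVec k)‖ := by
    have htranslate : Continuous fun q : (ℕ → DigitSystem d) × Rd d => (q.1, q.2 + intVec k) := by
      fun_prop
    exact (continuous_ft_law.comp htranslate).norm
  obtain ⟨ε, hε, hball⟩ := exists_pos_forall_exists_le_of_isCompact hK hcont fun q _ =>
    ((integralWavesTotal_law q.1).exists_ft_add_intVec_ne_zero q.2).imp fun _ => norm_pos_iff.2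
  refine isEquiPositive_of_forall_exists_le (C := 2 * Real.pi * √d) (by positivity) ?_
    (lt_min hε one_pos) ?_ ?_
  · rintro _ ⟨ω, -, rfl⟩
    exact norm_ft_law_sub_le ω
  · rintro _ ⟨ω, -, rfl⟩
    simp
  · rintro _ ⟨ω, hω, rfl⟩ ξ
    obtain ⟨l, hl⟩ := exists_norm_add_intVec_le ξ
    obtain ⟨k, hk⟩ := hball (ω, ξ + intVec l) ⟨fun n _ => hω n, mem_closedBall_zero_iff.2 hl⟩
    refine ⟨l + k, (min_le_left ε 1).trans ?_⟩
    rwa [intVec_add, ← add_assoc]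

end Compactness

section Spectrum

variable {ω : ℕ → DigitSystem d}

lemma isParsevalSet_partialLaw_zero :
    IsParsevalSet (partialLaw ω 0) ({0} : Finset (Fin d → ℤ)) :=
  isParsevalSet_coe.2 fun ξ => by simp [partialLaw_zero, ft]

lemma exists_superset_isParsevalSet_partialLaw
    (hdual : ∀ n, ∃ L : Finset (Fin d → ℤ), 0 ∈ L ∧
      IsParsevalSet (digitMeasure (ω n).m (ω n).B) L)
    {n N : ℕ} (hnN : n ≤ N) {Λ : Finset (Fin d → ℤ)} (hΛ : IsParsevalSet (partialLaw ω n) Λ) :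
    ∃ Λ' ⊇ Λ, IsParsevalSet (partialLaw ω N) Λ' := by
  induction N, hnN using Nat.le_induction with
  | base => exact ⟨Λ, Finset.Subset.rfl, hΛ⟩
  | succ N _ ih =>
    obtain ⟨Λ', hsub, hΛ'⟩ := ih
    obtain ⟨L, hzero, hL⟩ := hdual N
    refine ⟨_, fun l hl => ?_, hΛ'.image_product hL (isFTPeriodic_partialLaw ω N)
      (base_ne_zero ω N) (ft_partialLaw_succ ω N)⟩
    exact Finset.mem_image.2 ⟨(l, 0), Finset.mk_mem_product (hsub hl) hzero, by simp⟩

/-- A finite Parseval set of the `n`-th partial law at whose points, and within `δ` of them after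
rescaling, the Fourier transform of the law of the tail is at least `ε`. There the transform of
the partial law is at most `ε⁻¹` times that of the law of the whole series. -/
def IsDominatedSpectrum (ω : ℕ → DigitSystem d) (ε δ : ℝ) (n : ℕ) (Λ : Finset (Fin d → ℤ)) :
    Prop :=
  IsParsevalSet (partialLaw ω n) Λ ∧ ∀ l ∈ Λ, ∀ y, ‖y‖ < δ →
    ε ≤ ‖ft (law (shift n ω)) (scale (base ω n) (intVec l) + y)‖

lemma IsDominatedSpectrum.norm_ft_partialLaw_le {ε δ : ℝ} (hε : 0 < ε) {n : ℕ}
    {Λ : Finset (Fin d → ℤ)} (h : IsDominatedSpectrum ω ε δ n Λ) {ξ : Rd d}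
    (hξ : ‖scale (base ω n) ξ‖ < δ) {l : Fin d → ℤ} (hl : l ∈ Λ) :
    ‖ft (partialLaw ω n) (ξ + intVec l)‖ ≤ ε⁻¹ * ‖ft (law ω) (ξ + intVec l)‖ := by
  rw [inv_mul_eq_div, le_div_iff₀ hε, ft_law_eq_mul ω n, norm_mul, add_comm ξ, map_add]
  exact mul_le_mul_of_nonneg_left (h.2 l hl _ hξ) (norm_nonneg _)

lemma IsEquiPositive.exists_isDominatedSpectrum
    (heq : IsEquiPositive (Set.range fun n => law (shift n ω)))
    (hdual : ∀ n, ∃ L : Finset (Fin d → ℤ), 0 ∈ L ∧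
      IsParsevalSet (digitMeasure (ω n).m (ω n).B) L) :
    ∃ ε > 0, ∃ δ > 0, ∀ (n : ℕ) (Λ : Finset (Fin d → ℤ)), IsParsevalSet (partialLaw ω n) Λ →
      ∃ N > n, ∃ Λ' ⊇ Λ, IsDominatedSpectrum ω ε δ N Λ' := by
  obtain ⟨ε, hε, δ, hδ, hlower⟩ := heq
  refine ⟨ε, hε, δ / 2, half_pos hδ, fun n Λ hΛ => ?_⟩
  have hsmall : ∀ᶠ N in atTop, ∀ l ∈ Λ, ‖scale (base ω N) (intVec l)‖ < δ / 2 :=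
    (Finset.eventually_all Λ).2 fun l _ =>
      (tendsto_zero_iff_norm_tendsto_zero.1 (tendsto_scale_base ω _)).eventually_lt_const
        (half_pos hδ)
  obtain ⟨N, hN, hnN⟩ := (hsmall.and (eventually_gt_atTop n)).exists
  obtain ⟨hnear, hshift⟩ := hlower _ (Set.mem_range_self N)
  obtain ⟨Λ', hsub, hΛ'⟩ := exists_superset_isParsevalSet_partialLaw hdual hnN.le hΛ
  choose k hk using fun l : Fin d → ℤ => hshift (scale (base ω N) (intVec l))
  refine ⟨N, hnN, Λ'.image fun l => l + base ω N * if l ∈ Λ then 0 else k l, fun l hl => ?_,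
    hΛ'.image_add_mul (isFTPeriodic_partialLaw ω N) _, fun l hl y hy => ?_⟩
  · exact Finset.mem_image.2 ⟨l, hsub hl, by simp [hl]⟩
  obtain ⟨l, -, rfl⟩ := Finset.mem_image.1 hl
  split_ifs with hlΛ
  · rw [mul_zero, add_zero]
    exact hnear _ ((norm_add_le _ _).trans_lt (by linarith [hN l hlΛ]))
  · rw [intVec_add, map_add, scale_mul_intVec (base_ne_zero ω N)]
    exact hk l y (by linarith)

lemma exists_seq_isDominatedSpectrum {ε δ : ℝ}
    (hnext : ∀ (n : ℕ) (Λ : Finset (Fin d → ℤ)), IsParsevalSet (partialLaw ω n) Λ →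
      ∃ N > n, ∃ Λ' ⊇ Λ, IsDominatedSpectrum ω ε δ N Λ') :
    ∃ (n : ℕ → ℕ) (Λ : ℕ → Finset (Fin d → ℤ)), StrictMono n ∧ Monotone Λ ∧
      ∀ j, IsDominatedSpectrum ω ε δ (n j) (Λ j) := by
  let S := {p : ℕ × Finset (Fin d → ℤ) // IsDominatedSpectrum ω ε δ p.1 p.2}
  have hstep (p : S) : ∃ q : S, p.1.1 < q.1.1 ∧ p.1.2 ⊆ q.1.2 := by
    obtain ⟨N, hN, Λ', hΛ', h⟩ := hnext _ _ p.2.1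
    exact ⟨⟨(N, Λ'), h⟩, hN, hΛ'⟩
  choose next hlt hsub using hstep
  obtain ⟨N, -, Λ₀, -, h₀⟩ := hnext 0 _ isParsevalSet_partialLaw_zero
  let s (j : ℕ) : S := next^[j] ⟨(N, Λ₀), h₀⟩
  have hs (j : ℕ) : s (j + 1) = next (s j) := Function.iterate_succ_apply' _ _ _
  exact ⟨fun j => (s j).1.1, fun j => (s j).1.2,
    strictMono_nat_of_lt_succ fun j => hs j ▸ hlt (s j),
    monotone_nat_of_le_succ fun j => hs j ▸ hsub (s j), fun j => (s j).2⟩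

theorem exists_isSpectrum_law
    (hdual : ∀ n, ∃ L : Finset (Fin d → ℤ), IsParsevalSet (digitMeasure (ω n).m (ω n).B) L)
    (heq : IsEquiPositive (Set.range fun n => law (shift n ω))) :
    ∃ Λ ⊆ intLattice d, IsSpectrum (law ω) Λ := by
  obtain ⟨ε, hε, δ, hδ, hnext⟩ := heq.exists_isDominatedSpectrum fun n =>
    exists_zero_mem_isParsevalSet (hdual n)
  obtain ⟨n, Λ, hn, hΛ, hdominated⟩ := exists_seq_isDominatedSpectrum hnext
  have hparseval : IsParsevalSet (law ω) (⋃ j, (Λ j : Set (Fin d → ℤ))) := by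
    refine isParsevalSet_iUnion_of_tendsto hΛ (fun j => (hdominated j).1)
      (fun ξ => (tendsto_ft_partialLaw ω ξ).comp hn.tendsto_atTop) (C := ε⁻¹) fun ξ => ?_
    have hsmall : ∀ᶠ j in atTop, ‖scale (base ω (n j)) ξ‖ < δ :=
      (tendsto_zero_iff_norm_tendsto_zero.1
        ((tendsto_scale_base ω ξ).comp hn.tendsto_atTop)).eventually_lt_const hδ
    filter_upwards [hsmall] with j hj l hl
    exact (hdominated j).norm_ft_partialLaw_le hε hj hl
  exact ⟨_, Set.image_subset_range _ _, hparseval.isSpectrum (integralWavesTotal_law ω)⟩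

end Spectrum

lemma diagonal_le_opNorm (m : Fin d → ℤ) (i : Fin d) : (m i : ℝ) ≤ opNorm (Matrix.diagonal m) := by
  have hreal : realMat (Matrix.diagonal m) = Matrix.diagonal fun i => (m i : ℝ) :=
    Matrix.diagonal_map Int.cast_zero
  have hnorm : opNorm (Matrix.diagonal m) = ‖fun i => (m i : ℝ)‖ := by
    rw [opNorm, hreal]
    exact Matrix.l2_opNorm_diagonal _
  rw [hnorm]
  exact (le_abs_self _).trans (norm_le_pi_norm (fun i => (m i : ℝ)) i)

end InfConv

end

theorem theorem1p6 (d : ℕ) (R : ℕ → Matrix (Fin d) (Fin d) ℤ) (B : ℕ → Finset (Fin d → ℤ))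
    (hadm : ∀ n, InfConv.IsAdmissiblePair (R n) (B n))
    (hD : ∀ n, InfConv.MemD (R n) (B n))
    (hbdd : BddAbove (Set.range fun n => InfConv.opNorm (R n))) :
    ∃ μ : Measure (InfConv.Rd d), InfConv.IsInfiniteConvolution R B μ ∧
      ∃ Λ : Set (InfConv.Rd d), Λ ⊆ InfConv.intLattice d ∧ InfConv.IsSpectrum μ Λ := by
  choose ω hR hB using fun n => (hD n).exists_digitSystem
  obtain rfl : R = fun n => Matrix.diagonal (ω n).m := funext hR
  obtain rfl : B = fun n => (ω n).B := funext hB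
  refine ⟨InfConv.law ω, InfConv.isInfiniteConvolution_law ω, InfConv.exists_isSpectrum_law
    (fun n => (hadm n).exists_isParsevalSet (ω n).m_ne_zero (ω n).nonempty) ?_⟩
  obtain ⟨C, hC⟩ := hbdd
  have hm (n : ℕ) : (ω n).m ≤ fun _ => ⌊C⌋ := fun i =>
    Int.le_floor.2 ((InfConv.diagonal_le_opNorm _ i).trans (hC ⟨n, rfl⟩))
  refine (InfConv.isEquiPositive_law fun _ => ⌊C⌋).mono ?_
  rintro _ ⟨n, rfl⟩
  exact ⟨InfConv.shift n ω, fun k => hm (n + k), rfl⟩
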